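/- All Hilbert spaces are finite-dimensional, $\log$ is to base 2, and $S(\rho)=-\operatorname{Tr}\rho\log\rho$ is the von Neumann entropy; superscripts denote reduced states. For a bipartite state $\rho^{AB}$ the squashed entanglement is $$E_{sq}(\rho^{AB})=\inf\left\{\tfrac12 I(A;B|E)\ :\ \rho^{AB}=\operatorname{Tr}_E\rho^{ABE}\right\},$$ where $\rho^{ABE}$ ranges over all extensions of $\rho^{AB}$ (with $E$ of arbitrary finite dimension) and $I(A;B|E)=S(\rho^{AE})+S(\rho^{BE})-S(\rho^{E})-S(\rho^{ABE})$. Entanglement is always understood with respect to the cut between all $A$ systems ($A,A'$) and all $B$ systems ($B,B'$). Let $G$ be a finite abelian group of order $d\ge 1$ (for example $G=\mathbb{Z}_d$), let $i\mapsto\varphi_i$ be an isomorphism from $G$ onto its character group (for example $\varphi_i(k)=e^{2\pi\mathrm{i}\,ik/d}$ for $G=\mathbb{Z}_d$), let $A,B,C$ have orthonormal bases labelled by $G$, let $A',B'$ be qubits, and let $U_0=1$ and $U_1|i\rangle=\frac1{\sqrt d}\sum_{k\in G}\varphi_i(k)|k\rangle$ (the Fourier transform). Let $\rho^{AA'BB'}$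 be the flower state, i.e. the reduced state on $AA'BB'$ of $$|\Psi\rangle^{AA'BB'C}=\frac{1}{\sqrt{2d}}\sum_{i\in G}\sum_{j=0,1}|i\rangle^A|j\rangle^{A'}|i\rangle^B|j\rangle^{B'}\,U_j|i\rangle^C .$$ Then $$E_{sq}(\rho^{AA'BB'})=1+\tfrac12\log d\qquad\text{and}\qquad E_{sq}(\rho^{ABB'})=0 ,$$ where $\rho^{ABB'}$ is obtained by discarding the qubit $A'$. Consequently squashed entanglement is lockable: for every real $K$ there is a bipartite state $\rho^{AA'B}$, with $A'$ a qubit on the first party's side, such that $E_{sq}(\rho^{AA'B})-E_{sq}(\rho^{AB})\ge K$. -/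

import Mathlib

open scoped Matrix ComplexOrder

noncomputable section

/-- A quantum state on the finite-dimensional Hilbert space `ℂ^n`, with orthonormal basis labelled
by `n`: a positive semidefinite matrix of trace one. -/
@[ext]
structure DensityMatrix (n : Type*) [Fintype n] where
  toMatrix : Matrix n n ℂ
  posSemidef : toMatrix.PosSemidef
  trace_eq_one : toMatrix.trace = 1

namespace DensityMatrix

/-- The von Neumann entropy `S(ρ) = -Tr ρ log₂ ρ`, in bits. -/
def entropy {n : Type*} [Fintype n] [DecidableEq n] (ρ : DensityMatrix n) : ℝ :=
  (∑ i, Real.negMulLog (ρ.posSemidef.isHermitian.eigenvalues i)) / Real.log 2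

/-- Relabelling of the basis. -/
def reindex {m n : Type*} [Fintype m] [Fintype n] (e : m ≃ n) (ρ : DensityMatrix m) :
    DensityMatrix n where
  toMatrix := ρ.toMatrix.submatrix e.symm e.symm
  posSemidef := ρ.posSemidef.submatrix _
  trace_eq_one := by
    rw [← ρ.trace_eq_one]
    exact e.symm.sum_comp (fun i => ρ.toMatrix i i)

/-- The partial trace over the first tensor factor. -/
def traceLeft {m n : Type*} [Fintype m] [Fintype n] (ρ : DensityMatrix (m × n)) :
    DensityMatrix n where
  toMatrix := ∑ k : m, ρ.toMatrix.submatrix (fun i => (k, i)) (fun i => (k, i))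
  posSemidef := Matrix.posSemidef_sum _ fun _ _ => ρ.posSemidef.submatrix _
  trace_eq_one := by
    rw [← ρ.trace_eq_one, Matrix.trace_sum]
    exact (Fintype.sum_prod_type (fun x => ρ.toMatrix x x)).symm

/-- The partial trace over the second tensor factor. -/
def traceRight {m n : Type*} [Fintype m] [Fintype n] (ρ : DensityMatrix (m × n)) :
    DensityMatrix m where
  toMatrix := ∑ k : n, ρ.toMatrix.submatrix (fun i => (i, k)) (fun i => (i, k))
  posSemidef := Matrix.posSemidef_sum _ fun _ _ => ρ.posSemidef.submatrix _
  trace_eq_one := by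
    rw [← ρ.trace_eq_one, Matrix.trace_sum]
    exact (Fintype.sum_prod_type_right (fun x => ρ.toMatrix x x)).symm

/-- The pure state `|ψ⟩⟨ψ|` of a unit vector `ψ`. -/
def pure {n : Type*} [Fintype n] (ψ : n → ℂ) (hψ : ∑ i, ‖ψ i‖ ^ 2 = 1) : DensityMatrix n where
  toMatrix := Matrix.vecMulVec ψ (star ψ)
  posSemidef := Matrix.posSemidef_vecMulVec_self_star ψ
  trace_eq_one := by
    have h : ∀ i, ψ i * star (ψ i) = ((‖ψ i‖ ^ 2 : ℝ) : ℂ) := fun i => by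
      rw [Complex.star_def, Complex.mul_conj, Complex.normSq_eq_norm_sq]
    simp only [Matrix.trace, Matrix.diag, Matrix.vecMulVec_apply, Pi.star_apply, h]
    rw [← Complex.ofReal_sum, hψ, Complex.ofReal_one]

section Tripartite

variable {A B E : Type*} [Fintype A] [Fintype B] [Fintype E]

/-- The reduced state `ρ^{AE}` of `ρ^{ABE}`. -/
def margAE (ρ : DensityMatrix ((A × B) × E)) : DensityMatrix (A × E) :=
  (ρ.reindex (((Equiv.prodComm A B).prodCongr (Equiv.refl E)).trans
    (Equiv.prodAssoc B A E))).traceLeft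

/-- The reduced state `ρ^{BE}` of `ρ^{ABE}`. -/
def margBE (ρ : DensityMatrix ((A × B) × E)) : DensityMatrix (B × E) :=
  (ρ.reindex (Equiv.prodAssoc A B E)).traceLeft

/-- The quantum conditional mutual information
`I(A;B|E) = S(ρ^{AE}) + S(ρ^{BE}) - S(ρ^E) - S(ρ^{ABE})`. -/
def condMutualInfo [DecidableEq A] [DecidableEq B] [DecidableEq E]
    (ρ : DensityMatrix ((A × B) × E)) : ℝ :=
  ρ.margAE.entropy + ρ.margBE.entropy - ρ.traceLeft.entropy - ρ.entropy

/-- The squashed entanglement of `ρ^{AB}`: the infimum of `I(A;B|E) / 2` over all extensions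
`ρ^{ABE}` of `ρ^{AB}`, with `E` of arbitrary finite dimension. The infimum is taken in the extended
reals, so that no convention about unbounded or empty sets of reals enters. -/
def squashedEntanglement [DecidableEq A] [DecidableEq B] (ρ : DensityMatrix (A × B)) : EReal :=
  ⨅ (n : ℕ) (σ : DensityMatrix ((A × B) × Fin n)) (_ : σ.traceRight = ρ),
    ((σ.condMutualInfo / 2 : ℝ) : EReal)

end Tripartite

/-- Discarding the subsystem `A'` of a state on `AA'B`, where `AA'` is Alice's system. -/
def discardA' {A A' B : Type*} [Fintype A] [Fintype A'] [Fintype B]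
    (ρ : DensityMatrix ((A × A') × B)) : DensityMatrix (A × B) :=
  (ρ.reindex (((Equiv.prodComm A A').prodCongr (Equiv.refl B)).trans
    (Equiv.prodAssoc A' A B))).traceLeft

end DensityMatrix

/-- Squashed entanglement is lockable: it can drop by an arbitrarily large amount when a single
qubit `A'` of a local system `AA'` is discarded. -/
def SquashedEntanglementIsLockable : Prop :=
  ∀ K : ℝ, ∃ (A B : Type) (_ : Fintype A) (_ : DecidableEq A) (_ : Fintype B) (_ : DecidableEq B)
    (ρ : DensityMatrix ((A × Fin 2) × B)) (x y : ℝ),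
    ρ.squashedEntanglement = (x : EReal) ∧ ρ.discardA'.squashedEntanglement = (y : EReal) ∧
      K ≤ x - y

section Flower

variable {G : Type*} [AddCommGroup G] [Fintype G]

/-- The unitary Fourier transform of the finite abelian group `G`, whose basis labels are identified
with the characters of `G` through `φ`: `U|i⟩ = |G|^{-1/2} ∑_k φ_i(k) |k⟩`. For `G = ℤ/d` and
`φ_i(k) = exp(2π𝐢 i k / d)` this is the usual discrete Fourier transform of dimension `d`. -/
def fourierMatrix (φ : G ≃+ AddChar G ℂ) : Matrix G G ℂ :=
  Matrix.of fun k i => ((1 / √(Fintype.card G : ℝ) : ℝ) : ℂ) * φ i k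

/-- The unitaries `U₀ = 1` and `U₁`, the Fourier transform. -/
def flowerUnitary [DecidableEq G] (φ : G ≃+ AddChar G ℂ) (j : Fin 2) : Matrix G G ℂ :=
  if j = 0 then 1 else fourierMatrix φ

/-- The standard basis vector `|i⟩`. -/
def ket {n : Type*} [DecidableEq n] (i : n) : n → ℂ := Pi.single i 1

/-- The vector `(2d)^{-1/2} ∑_{i,j} |i⟩^A |j⟩^{A'} |i⟩^B |j⟩^{B'} U_j|i⟩^C`, with `d = |G|`. -/
def flowerVector [DecidableEq G] (φ : G ≃+ AddChar G ℂ) :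
    ((G × Fin 2) × (G × Fin 2)) × G → ℂ :=
  fun x => ((1 / √(2 * Fintype.card G : ℝ) : ℝ) : ℂ) * ∑ i : G, ∑ j : Fin 2,
    ket i x.1.1.1 * ket j x.1.1.2 * ket i x.1.2.1 * ket j x.1.2.2 *
      (flowerUnitary φ j *ᵥ ket i) x.2

lemma flowerVector_apply [DecidableEq G] (φ : G ≃+ AddChar G ℂ) (a b c : G) (a' b' : Fin 2) :
    flowerVector φ (((a, a'), (b, b')), c) =
      if a = b ∧ a' = b' then
        ((1 / √(2 * Fintype.card G : ℝ) : ℝ) : ℂ) * flowerUnitary φ a' c a else 0 := by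
  simp only [flowerVector, ket, Matrix.mulVec_single_one, Matrix.col_apply]
  rw [Finset.sum_eq_single a, Finset.sum_eq_single a']
  · by_cases h : a = b
    · subst h
      by_cases h' : a' = b'
      · subst h'; simp
      · simp [h', Ne.symm h']
    · simp [h, Pi.single_apply, Ne.symm h]
  · intro j _ hj; simp [Pi.single_apply, Ne.symm hj]
  · simp
  · intro i _ hi; simp [Pi.single_apply, Ne.symm hi]
  · simp

lemma sum_norm_sq_flowerUnitary [DecidableEq G] (φ : G ≃+ AddChar G ℂ) (j : Fin 2) (i : G) :
    ∑ c, ‖flowerUnitary φ j c i‖ ^ 2 = 1 := by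
  have hd : (Fintype.card G : ℝ) ≠ 0 := by exact_mod_cast Fintype.card_ne_zero
  by_cases hj : j = 0
  · rw [Finset.sum_eq_single i] <;> simp +contextual [flowerUnitary, hj]
  · simp [flowerUnitary, hj, fourierMatrix, AddChar.norm_apply, hd]

lemma sum_norm_sq_flowerVector [DecidableEq G] (φ : G ≃+ AddChar G ℂ) :
    ∑ x, ‖flowerVector φ x‖ ^ 2 = 1 := by
  have hd : (Fintype.card G : ℝ) ≠ 0 := by exact_mod_cast Fintype.card_ne_zero
  have key : ∀ a a' b b', ∑ c, ‖flowerVector φ (((a, a'), (b, b')), c)‖ ^ 2 =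
      if a = b ∧ a' = b' then 1 / (2 * Fintype.card G : ℝ) else 0 := by
    intro a a' b b'
    simp only [flowerVector_apply]
    split_ifs with h
    · simp only [norm_mul, mul_pow, ← Finset.mul_sum, sum_norm_sq_flowerUnitary, mul_one,
        Complex.norm_real, Real.norm_eq_abs, sq_abs, div_pow, one_pow]
      rw [Real.sq_sqrt (by positivity)]
    · simp
  rw [Fintype.sum_prod_type, Fintype.sum_prod_type]
  have key' : ∀ p q : G × Fin 2, ∑ c, ‖flowerVector φ ((p, q), c)‖ ^ 2 =
      if p = q then 1 / (2 * Fintype.card G : ℝ) else 0 := fun p q => by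
    simpa only [Prod.ext_iff] using key p.1 p.2 q.1 q.2
  simp only [key', Finset.sum_ite_eq, Finset.mem_univ, if_true, Finset.sum_const,
    Finset.card_univ, Fintype.card_prod, Fintype.card_fin, nsmul_eq_mul]
  push_cast
  field_simp

/-- The flower state `ρ^{AA'BB'}`: the reduction to `AA'BB'` of the pure state above. -/
def flowerState [DecidableEq G] (φ : G ≃+ AddChar G ℂ) :
    DensityMatrix ((G × Fin 2) × (G × Fin 2)) :=
  (DensityMatrix.pure (flowerVector φ) (sum_norm_sq_flowerVector φ)).traceRight

end Flower

end

open Matrix Finset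


/-! The flower state is `1/d` times the projection onto the range of an isometry `N` from `C` to
`AA'BB'`. Hence every extension has the form `(N ⊗ 1) T (N ⊗ 1)ᴴ` for a state `T` of `E` and `C`
(`extension_eq_conj`). The label `x = (i, j)` is copied on both sides, so tracing out either party
leaves a direct sum over `x` of half the unnormalized state of `E` obtained when `C` is measured in
basis `j` with outcome `i`. In nats this gives `I = ∑ₓ S(Eₓ) + 2 log 2 - S(E) - S(EC)`
(`condMutualInfo_eq`). The computational and Fourier bases are mutually unbiased, and the entropic
uncertainty relation with side information `E` (`uncertainty_relation`) bounds `∑ₓ S(Eₓ)` below by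
`S(E) + S(EC) + log d`. The trivial extension attains the bound.

Without `A'` the state is classical, and a copy of the label in `E` makes the conditional mutual
information vanish. That it cannot be negative is strong subadditivity.

Both entropy inequalities come from monotonicity of relative entropy
(`IsEntropyPair.vonNeumann_sub_le`). For uncertainty, `T` is compared with its dephasing in one
basis and both are measured in the other; for strong subadditivity, a state is compared with its
partially mixed version and a factor is traced out. In each pair relative entropy is a difference of
entropies. Monotonicity is proved by writing relative entropy as an integral of quadratic forms,
each the maximum of a concave functional that a channel can only decrease, by a Kadison-Schwarz
inequality. Entropies are compared through traces of powers, which avoids matching eigenvalue lists.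
-/

namespace QuantumEntropy

/-! ### Spectral decomposition and traces of powers. -/

section Spectral

variable {n : Type*} [Fintype n] [DecidableEq n]

/-- The matrix whose columns are eigenvectors of a Hermitian matrix. -/
noncomputable def eigenMatrix {A : Matrix n n ℂ} (hA : A.IsHermitian) : Matrix n n ℂ :=
  hA.eigenvectorUnitary

lemma eigenMatrix_conjTranspose_mul_self {A : Matrix n n ℂ} (hA : A.IsHermitian) :
    (eigenMatrix hA)ᴴ * eigenMatrix hA = 1 :=
  Unitary.coe_star_mul_self hA.eigenvectorUnitary

lemma eigenMatrix_mul_conjTranspose_self {A : Matrix n n ℂ} (hA : A.IsHermitian) :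
    eigenMatrix hA * (eigenMatrix hA)ᴴ = 1 :=
  Unitary.coe_mul_star_self hA.eigenvectorUnitary

lemma eq_eigenMatrix_mul_diagonal {A : Matrix n n ℂ} (hA : A.IsHermitian) :
    A = eigenMatrix hA * diagonal (fun i => (hA.eigenvalues i : ℂ)) * (eigenMatrix hA)ᴴ := by
  conv_lhs => rw [hA.spectral_theorem, Unitary.conjStarAlgAut_apply]
  rfl

lemma conjTranspose_eigenMatrix_mul {A : Matrix n n ℂ} (hA : A.IsHermitian) :
    (eigenMatrix hA)ᴴ * A = diagonal (fun i => (hA.eigenvalues i : ℂ)) * (eigenMatrix hA)ᴴ := by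
  conv_lhs => arg 2; rw [eq_eigenMatrix_mul_diagonal hA]
  rw [← mul_assoc, ← mul_assoc, eigenMatrix_conjTranspose_mul_self, one_mul]

lemma mul_eigenMatrix {A : Matrix n n ℂ} (hA : A.IsHermitian) :
    A * eigenMatrix hA = eigenMatrix hA * diagonal (fun i => (hA.eigenvalues i : ℂ)) := by
  conv_lhs => arg 1; rw [eq_eigenMatrix_mul_diagonal hA]
  rw [mul_assoc, eigenMatrix_conjTranspose_mul_self, mul_one]

lemma pow_mul_eigenMatrix {A : Matrix n n ℂ} (hA : A.IsHermitian) (k : ℕ) :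
    A ^ k * eigenMatrix hA =
      eigenMatrix hA * diagonal (fun i => (hA.eigenvalues i : ℂ) ^ k) := by
  induction k with
  | zero => simp
  | succ k ih =>
    rw [pow_succ, mul_assoc, mul_eigenMatrix, ← mul_assoc, ih, mul_assoc, diagonal_mul_diagonal]
    simp only [pow_succ]

lemma trace_eigenMatrix_conj {A : Matrix n n ℂ} (hA : A.IsHermitian) (C : Matrix n n ℂ) :
    ((eigenMatrix hA)ᴴ * C * eigenMatrix hA).trace = C.trace := by
  rw [mul_assoc, trace_mul_comm, mul_assoc, eigenMatrix_mul_conjTranspose_self, mul_one]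

lemma trace_mul_pow {A : Matrix n n ℂ} (hA : A.IsHermitian) (C : Matrix n n ℂ) (k : ℕ) :
    (C * A ^ k).trace =
      ∑ i, ((eigenMatrix hA)ᴴ * C * eigenMatrix hA) i i * (hA.eigenvalues i : ℂ) ^ k := by
  rw [← trace_eigenMatrix_conj hA, mul_assoc, mul_assoc, pow_mul_eigenMatrix, ← mul_assoc,
    ← mul_assoc]
  simp [trace, mul_diagonal]

lemma trace_pow {A : Matrix n n ℂ} (hA : A.IsHermitian) (k : ℕ) :
    (A ^ k).trace = ((∑ i, hA.eigenvalues i ^ k : ℝ) : ℂ) := by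
  have := trace_mul_pow hA 1 k
  rw [one_mul, mul_one, eigenMatrix_conjTranspose_mul_self] at this
  simpa using this

end Spectral

/-! ### Finite point masses and their moments. -/

section Interpolation

variable {ι κ : Type*} [Fintype ι] [Fintype κ]

/-- Weighted point masses on the line are determined by their moments. -/
lemma sum_mul_apply_eq_of_moments {w a : ι → ℝ} {c b : κ → ℝ}
    (h : ∀ k : ℕ, ∑ i, w i * a i ^ k = ∑ j, c j * b j ^ k) (f : ℝ → ℝ) :
    ∑ i, w i * f (a i) = ∑ j, c j * f (b j) := by
  classical
  -- Only the values of `f` at finitely many nodes matter, so `f` may be replaced by its Lagrange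
  -- interpolation polynomial, for which equality of moments suffices.
  set S : Finset ℝ := univ.image a ∪ univ.image b with hS
  set p := Lagrange.interpolate S id f with hp
  have hev : ∀ x ∈ S, p.eval x = f x := fun x hx =>
    Lagrange.eval_interpolate_at_node (s := S) (v := id) f Function.injective_id.injOn hx
  have ha : ∀ i, f (a i) = p.eval (a i) := fun i =>
    (hev _ (mem_union_left _ (mem_image_of_mem _ (mem_univ i)))).symm
  have hb : ∀ j, f (b j) = p.eval (b j) := fun j =>
    (hev _ (mem_union_right _ (mem_image_of_mem _ (mem_univ j)))).symm
  simp only [ha, hb, Polynomial.eval_eq_sum_range, mul_sum]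
  rw [sum_comm, sum_comm (s := univ (α := κ))]
  refine sum_congr rfl fun k _ => ?_
  have := congrArg (p.coeff k * ·) (h k)
  simp only [mul_sum] at this
  convert this using 2 <;> ring

/-- Point masses away from the origin are determined by their positive moments. -/
lemma sum_mul_apply_eq_of_pos_moments {w a : ι → ℝ} {c b : κ → ℝ}
    (h : ∀ k : ℕ, ∑ i, w i * a i ^ (k + 1) = ∑ j, c j * b j ^ (k + 1)) {f : ℝ → ℝ}
    (hf : f 0 = 0) : ∑ i, w i * f (a i) = ∑ j, c j * f (b j) := by
  -- One factor of the position moves into the weights and `f x / x` becomes the test function; at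
  -- the origin nothing is lost because `f 0 = 0`.
  have h' := sum_mul_apply_eq_of_moments (w := fun i => w i * a i) (a := a)
    (c := fun j => c j * b j) (b := b) (fun k => by simpa [pow_succ', mul_assoc] using h k)
    (fun x => f x / x)
  have key : ∀ x, x * (f x / x) = f x := fun x => by
    by_cases hx : x = 0
    · simp [hx, hf]
    · field_simp
  simpa only [mul_assoc, key] using h'

end Interpolation

/-- The von Neumann entropy, in nats, of a Hermitian matrix that need not be normalized. -/
noncomputable def vonNeumann {n : Type*} [Fintype n] [DecidableEq n] {A : Matrix n n ℂ}
    (hA : A.IsHermitian) : ℝ :=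
  ∑ i, Real.negMulLog (hA.eigenvalues i)

/-! ### Entropy from traces of powers. -/

section Entropy

variable {n : Type*} [Fintype n] [DecidableEq n]

/-- The entropy of a matrix whose power traces are sums of power traces of rescaled matrices. -/
lemma vonNeumann_eq_sum {κ : Type*} [Fintype κ] {m : κ → Type*} [∀ j, Fintype (m j)]
    [∀ j, DecidableEq (m j)] {A : Matrix n n ℂ} (hA : A.IsHermitian)
    {B : ∀ j, Matrix (m j) (m j) ℂ} (hB : ∀ j, (B j).IsHermitian) (c s : κ → ℝ)
    (h : ∀ k : ℕ, (A ^ (k + 1)).trace = ∑ j, (c j : ℂ) * (s j : ℂ) ^ (k + 1) *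
      ((B j) ^ (k + 1)).trace) :
    vonNeumann hA = ∑ j, c j * (s j * vonNeumann (hB j) +
      Real.negMulLog (s j) * (B j).trace.re) := by
  -- Up to zeros, the spectrum of `A` is that of the rescaled blocks `s j • B j` counted with weight
  -- `c j`. Only positive powers are compared, so the dimensions need not agree.
  have h1 : ∀ k : ℕ, ∑ i, (1 : ℝ) * hA.eigenvalues i ^ (k + 1) =
      ∑ x : Σ j, m j, c x.1 * (s x.1 * (hB x.1).eigenvalues x.2) ^ (k + 1) := fun k => by
    have := h k
    simp only [trace_pow hA, trace_pow (hB _)] at this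
    rw [Fintype.sum_sigma]
    have h2 : ∑ i, hA.eigenvalues i ^ (k + 1) =
        ∑ j, c j * s j ^ (k + 1) * ∑ i, (hB j).eigenvalues i ^ (k + 1) := by
      exact_mod_cast this
    simp only [one_mul, h2, mul_sum, mul_pow, mul_assoc]
  have h2 := sum_mul_apply_eq_of_pos_moments h1 (f := Real.negMulLog) (by simp)
  rw [Fintype.sum_sigma] at h2
  simp only [one_mul] at h2
  rw [vonNeumann, h2]
  refine sum_congr rfl fun j _ => ?_
  have h3 : (B j).trace.re = ∑ i, (hB j).eigenvalues i := by
    have := trace_pow (hB j) 1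
    simp only [pow_one] at this
    rw [this, Complex.ofReal_re]
  simp only [vonNeumann, h3, mul_sum, ← sum_add_distrib, Real.negMulLog_mul]
  refine sum_congr rfl fun i _ => ?_
  ring

lemma vonNeumann_eq_of_trace_pow {m : Type*} [Fintype m] [DecidableEq m] {A : Matrix n n ℂ}
    (hA : A.IsHermitian) {B : Matrix m m ℂ} (hB : B.IsHermitian)
    (h : ∀ k : ℕ, (A ^ (k + 1)).trace = (B ^ (k + 1)).trace) : vonNeumann hA = vonNeumann hB := by
  simpa using vonNeumann_eq_sum (κ := Unit) (m := fun _ => m) hA (B := fun _ => B) (fun _ => hB)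
    (fun _ => 1) (fun _ => 1) (fun k => by simpa using h k)

lemma vonNeumann_congr {A B : Matrix n n ℂ} (hA : A.IsHermitian) (hB : B.IsHermitian)
    (h : A = B) : vonNeumann hA = vonNeumann hB := by
  subst h; rfl

end Entropy

/-! ### Taylor remainder of `x log x`. -/

section ScalarIntegral

/-- The scalar integral formula behind the integral representation of the relative entropy. -/
lemma relativeEntropy_integral {a b : ℝ} (ha : 0 ≤ a) (hb : 0 ≤ b) (hab : b = 0 → a = 0) :
    IntervalIntegrable (fun s : ℝ => (1 - s) * ((a - b) ^ 2 / ((1 - s) * b + s * a)))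
      MeasureTheory.volume 0 1 ∧
    ∫ s in (0 : ℝ)..1, (1 - s) * ((a - b) ^ 2 / ((1 - s) * b + s * a)) =
      a * Real.log a - a * Real.log b - a + b := by
  rcases hb.eq_or_lt with rfl | hb
  · simp [hab rfl]
  rcases ha.eq_or_lt with rfl | ha
  · have h : Set.EqOn (fun s : ℝ => (1 - s) * ((0 - b) ^ 2 / ((1 - s) * b + s * 0)))
        (fun _ => b) (Set.Ioo 0 1) := fun s hs => by
      have : 1 - s ≠ 0 := by linarith [hs.2]
      simp only
      field_simp
      ring
    -- For `a = 0` the integrand is the constant `b` except at `s = 1`, where it vanishes.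
    have h' : ∀ᵐ s : ℝ, s ∈ Set.uIoc (0 : ℝ) 1 →
        (1 - s) * ((0 - b) ^ 2 / ((1 - s) * b + s * 0)) = b := by
      have : ∀ᵐ s : ℝ, s ≠ 1 := by simp [MeasureTheory.ae_iff]
      filter_upwards [this] with s hs hs'
      rw [Set.uIoc_of_le zero_le_one] at hs'
      exact h ⟨hs'.1, lt_of_le_of_ne hs'.2 hs⟩
    constructor
    · refine (intervalIntegrable_const (c := b)).congr_ae ?_
      rw [Filter.EventuallyEq, MeasureTheory.ae_restrict_iff' measurableSet_uIoc]
      filter_upwards [h'] with s hs hs' using (hs hs').symm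
    · rw [intervalIntegral.integral_congr_ae h']
      simp
  · have hp : ∀ s ∈ Set.uIcc (0 : ℝ) 1, 0 < (1 - s) * b + s * a := fun s hs => by
      rw [Set.uIcc_of_le zero_le_one] at hs
      rcases hs.1.eq_or_lt with rfl | h0
      · simpa using hb
      · nlinarith [hs.2, mul_pos h0 ha, mul_nonneg (sub_nonneg.2 hs.2) hb.le]
    have hd : ∀ s ∈ Set.uIcc (0 : ℝ) 1,
        HasDerivAt (fun s : ℝ => a * Real.log ((1 - s) * b + s * a) - (a - b) * s)
          ((1 - s) * ((a - b) ^ 2 / ((1 - s) * b + s * a))) s := fun s hs => by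
      have h1 : HasDerivAt (fun s : ℝ => (1 - s) * b + s * a) (a - b) s := by
        exact ((((hasDerivAt_id' s).const_sub 1).mul_const b).add
          ((hasDerivAt_id' s).mul_const a)).congr_deriv (by ring)
      refine (((h1.log (hp s hs).ne').const_mul a).sub
        ((hasDerivAt_id' s).const_mul (a - b))).congr_deriv ?_
      have hq := (hp s hs).ne'
      generalize hq' : (1 - s) * b + s * a = q at hq
      field_simp
      rw [← hq']
      ring
    have hint : IntervalIntegrable
        (fun s : ℝ => (1 - s) * ((a - b) ^ 2 / ((1 - s) * b + s * a)))
        MeasureTheory.volume 0 1 := by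
      refine ContinuousOn.intervalIntegrable ?_
      refine ContinuousOn.mul (by fun_prop) (ContinuousOn.div (by fun_prop) (by fun_prop) ?_)
      exact fun s hs => (hp s hs).ne'
    refine ⟨hint, ?_⟩
    rw [intervalIntegral.integral_eq_sub_of_hasDerivAt hd hint]
    simp
    ring

end ScalarIntegral

/-! ### Relative entropy as an integral of maxima of concave functionals. -/

section RelativeEntropy

variable {n : Type*} [Fintype n] [DecidableEq n] {A B : Matrix n n ℂ}

/-- The squared overlaps of the eigenvectors of two Hermitian matrices. -/
noncomputable def overlapSq (hA : A.IsHermitian) (hB : B.IsHermitian) (i j : n) : ℝ :=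
  ‖((eigenMatrix hA)ᴴ * eigenMatrix hB) i j‖ ^ 2

lemma overlapSq_nonneg (hA : A.IsHermitian) (hB : B.IsHermitian) (i j : n) :
    0 ≤ overlapSq hA hB i j := by
  unfold overlapSq; positivity

lemma mul_star_eq_norm_sq (z : ℂ) : z * star z = ((‖z‖ ^ 2 : ℝ) : ℂ) := by
  rw [Complex.star_def, Complex.mul_conj, Complex.normSq_eq_norm_sq]

lemma star_mul_eq_norm_sq (z : ℂ) : star z * z = ((‖z‖ ^ 2 : ℝ) : ℂ) := by
  rw [mul_comm, mul_star_eq_norm_sq]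

lemma sum_overlapSq_right (hA : A.IsHermitian) (hB : B.IsHermitian) (i : n) :
    ∑ j, overlapSq hA hB i j = 1 := by
  set O := (eigenMatrix hA)ᴴ * eigenMatrix hB with hO
  have h : O * Oᴴ = 1 := by
    rw [hO, conjTranspose_mul, conjTranspose_conjTranspose, mul_assoc,
      ← mul_assoc (eigenMatrix hB), eigenMatrix_mul_conjTranspose_self, one_mul,
      eigenMatrix_conjTranspose_mul_self]
  have h1 := congrFun (congrFun h i) i
  simp only [mul_apply, conjTranspose_apply, mul_star_eq_norm_sq, one_apply_eq] at h1
  exact_mod_cast h1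

lemma sum_overlapSq_left (hA : A.IsHermitian) (hB : B.IsHermitian) (j : n) :
    ∑ i, overlapSq hA hB i j = 1 := by
  set O := (eigenMatrix hA)ᴴ * eigenMatrix hB with hO
  have h : Oᴴ * O = 1 := by
    rw [hO, conjTranspose_mul, conjTranspose_conjTranspose, mul_assoc,
      ← mul_assoc (eigenMatrix hA), eigenMatrix_mul_conjTranspose_self, one_mul,
      eigenMatrix_conjTranspose_mul_self]
  have h1 := congrFun (congrFun h j) j
  simp only [mul_apply, conjTranspose_apply, star_mul_eq_norm_sq, one_apply_eq] at h1
  exact_mod_cast h1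

lemma eigenMatrix_conj_apply_self (hA : A.IsHermitian) (hB : B.IsHermitian) (j : n) :
    ((eigenMatrix hB)ᴴ * A * eigenMatrix hB) j j =
      ((∑ i, overlapSq hA hB i j * hA.eigenvalues i : ℝ) : ℂ) := by
  set O := (eigenMatrix hA)ᴴ * eigenMatrix hB with hO
  have h : (eigenMatrix hB)ᴴ * A * eigenMatrix hB =
      Oᴴ * (diagonal (fun i => (hA.eigenvalues i : ℂ)) * O) := by
    conv_lhs => rw [eq_eigenMatrix_mul_diagonal hA]
    simp only [hO, conjTranspose_mul, conjTranspose_conjTranspose, mul_assoc]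
  rw [h, mul_apply]
  simp only [diagonal_mul, conjTranspose_apply]
  push_cast
  refine sum_congr rfl fun i _ => ?_
  have : ((overlapSq hA hB i j : ℝ) : ℂ) = star (O i j) * O i j := (star_mul_eq_norm_sq _).symm
  rw [this]
  ring

/-- The quantum relative entropy `Tr (A log A - A log B - A + B)`, in nats. -/
noncomputable def relEntropy (hA : A.IsHermitian) (hB : B.IsHermitian) : ℝ :=
  ∑ i, ∑ j, overlapSq hA hB i j *
    (hA.eigenvalues i * Real.log (hA.eigenvalues i) -
      hA.eigenvalues i * Real.log (hB.eigenvalues j) - hA.eigenvalues i + hB.eigenvalues j)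

/-- The quadratic form `Tr (A - B)ᴴ ((1 - s) R_B + s L_A)⁻¹ (A - B)`, where `L_A` and `R_B` denote
left and right multiplication. -/
noncomputable def resolventForm (hA : A.IsHermitian) (hB : B.IsHermitian) (s : ℝ) : ℝ :=
  ∑ i, ∑ j, overlapSq hA hB i j * ((hA.eigenvalues i - hB.eigenvalues j) ^ 2 /
    ((1 - s) * hB.eigenvalues j + s * hA.eigenvalues i))

/-- The concave functional of `W` whose maximum is `resolventForm`. -/
noncomputable def variationalForm (A B : Matrix n n ℂ) (s : ℝ) (W : Matrix n n ℂ) : ℝ :=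
  2 * (Wᴴ * (A - B)).trace.re - (1 - s) * (W * B * Wᴴ).trace.re - s * (Wᴴ * A * W).trace.re

/-- Since `A` acts on the left and `B` on the right, using the eigenbasis of `A` for rows and that
of `B` for columns diagonalizes the quadratic part, and the entries of `W` decouple. -/
lemma variationalForm_eq_sum (hA : A.IsHermitian) (hB : B.IsHermitian) (s : ℝ)
    (W : Matrix n n ℂ) :
    variationalForm A B s (eigenMatrix hA * W * (eigenMatrix hB)ᴴ) =
      ∑ i, ∑ j, (2 * (star (W i j) * ((eigenMatrix hA)ᴴ * eigenMatrix hB) i j).re *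
        (hA.eigenvalues i - hB.eigenvalues j) -
        ((1 - s) * hB.eigenvalues j + s * hA.eigenvalues i) * ‖W i j‖ ^ 2) := by
  set U := eigenMatrix hA with hU
  set V := eigenMatrix hB with hV
  set a := hA.eigenvalues
  set b := hB.eigenvalues
  have hUU : Uᴴ * U = 1 := eigenMatrix_conjTranspose_mul_self hA
  have hVV : Vᴴ * V = 1 := eigenMatrix_conjTranspose_mul_self hB
  have h1 : ((U * W * Vᴴ)ᴴ * (A - B)).trace =
      ∑ i, ∑ j, star (W i j) * (Uᴴ * V) i j * ((a i : ℂ) - b j) := by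
    have e1 : ((U * W * Vᴴ)ᴴ * (A - B)).trace = (Wᴴ * (Uᴴ * (A - B) * V)).trace := by
      simp only [conjTranspose_mul, conjTranspose_conjTranspose, mul_assoc]
      rw [trace_mul_comm]
      simp only [mul_assoc]
    have e2 : Uᴴ * (A - B) * V = diagonal (fun i => (a i : ℂ)) * (Uᴴ * V) -
        (Uᴴ * V) * diagonal (fun i => (b i : ℂ)) := by
      rw [mul_sub, sub_mul, conjTranspose_eigenMatrix_mul, mul_assoc, mul_assoc Uᴴ B,
        mul_eigenMatrix, mul_assoc]
    rw [e1, e2, trace]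
    simp only [Matrix.diag, Matrix.mul_apply (M := Wᴴ), Matrix.sub_apply, diagonal_mul,
      mul_diagonal, conjTranspose_apply]
    rw [sum_comm]
    refine sum_congr rfl fun i _ => sum_congr rfl fun j _ => ?_
    ring
  have h2 : (U * W * Vᴴ * B * (U * W * Vᴴ)ᴴ).trace =
      ((∑ i, ∑ j, b j * ‖W i j‖ ^ 2 : ℝ) : ℂ) := by
    have e1 : (U * W * Vᴴ * B * (U * W * Vᴴ)ᴴ).trace =
        (W * diagonal (fun i => (b i : ℂ)) * Wᴴ).trace := by
      have : U * W * Vᴴ * B * (U * W * Vᴴ)ᴴ =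
          U * (W * (diagonal (fun i => (b i : ℂ)) * (Vᴴ * V) * Wᴴ) * Uᴴ) := by
        rw [mul_assoc (U * W), conjTranspose_eigenMatrix_mul]
        simp only [conjTranspose_mul, conjTranspose_conjTranspose, mul_assoc]
        rfl
      rw [this, trace_mul_comm, mul_assoc, hUU, hVV]
      simp only [mul_assoc, mul_one]
    rw [e1, trace]
    push_cast
    refine sum_congr rfl fun i _ => ?_
    rw [Matrix.diag, Matrix.mul_apply]
    refine sum_congr rfl fun j _ => ?_
    have := mul_star_eq_norm_sq (W i j)
    push_cast at this
    rw [mul_diagonal, conjTranspose_apply, ← this]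
    ring
  have h3 : ((U * W * Vᴴ)ᴴ * A * (U * W * Vᴴ)).trace =
      ((∑ i, ∑ j, a i * ‖W i j‖ ^ 2 : ℝ) : ℂ) := by
    have e1 : ((U * W * Vᴴ)ᴴ * A * (U * W * Vᴴ)).trace =
        (Wᴴ * diagonal (fun i => (a i : ℂ)) * W).trace := by
      have : (U * W * Vᴴ)ᴴ * A * (U * W * Vᴴ) =
          V * (Wᴴ * (diagonal (fun i => (a i : ℂ)) * (Uᴴ * U) * W) * Vᴴ) := by
        simp only [conjTranspose_mul, conjTranspose_conjTranspose, mul_assoc]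
        rw [← mul_assoc Uᴴ A, conjTranspose_eigenMatrix_mul]
        simp only [mul_assoc]
        rfl
      rw [this, trace_mul_comm, mul_assoc, hUU, hVV]
      simp only [mul_assoc, mul_one]
    rw [e1, trace]
    simp only [Matrix.diag, Matrix.mul_apply (N := W), mul_diagonal, conjTranspose_apply]
    rw [sum_comm]
    push_cast
    refine sum_congr rfl fun i _ => sum_congr rfl fun j _ => ?_
    have := mul_star_eq_norm_sq (W i j)
    push_cast at this
    rw [← this]
    ring
  rw [variationalForm, h1, h2, h3, Complex.ofReal_re, Complex.ofReal_re, Complex.re_sum, mul_sum,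
    mul_sum, mul_sum, ← sum_sub_distrib, ← sum_sub_distrib]
  refine sum_congr rfl fun i _ => ?_
  rw [Complex.re_sum, mul_sum, mul_sum, mul_sum, ← sum_sub_distrib, ← sum_sub_distrib]
  refine sum_congr rfl fun j _ => ?_
  rw [← Complex.ofReal_sub, Complex.re_mul_ofReal]
  ring

/-- Completing the square in each entry. As `0 < s < 1`, a vanishing denominator forces both
eigenvalues to vanish, and then the entry contributes nothing. -/
lemma variationalForm_le (hA : A.PosSemidef) (hB : B.PosSemidef) {s : ℝ} (hs : s ∈ Set.Ioo 0 1)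
    (W : Matrix n n ℂ) :
    variationalForm A B s W ≤ resolventForm hA.isHermitian hB.isHermitian s := by
  set hA' := hA.isHermitian
  set hB' := hB.isHermitian
  have hW : W = eigenMatrix hA' * ((eigenMatrix hA')ᴴ * W * eigenMatrix hB') *
      (eigenMatrix hB')ᴴ := by
    simp only [mul_assoc, eigenMatrix_mul_conjTranspose_self, mul_one]
    rw [← mul_assoc, eigenMatrix_mul_conjTranspose_self, one_mul]
  rw [hW, variationalForm_eq_sum]
  refine sum_le_sum fun i _ => sum_le_sum fun j _ => ?_
  set w := ((eigenMatrix hA')ᴴ * W * eigenMatrix hB') i j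
  set o := ((eigenMatrix hA')ᴴ * eigenMatrix hB') i j with ho
  have ha : 0 ≤ hA'.eigenvalues i := hA.eigenvalues_nonneg i
  have hb : 0 ≤ hB'.eigenvalues j := hB.eigenvalues_nonneg j
  set a := hA'.eigenvalues i
  set b := hB'.eigenvalues j
  have h0 : 0 ≤ (1 - s) * b := mul_nonneg (by linarith [hs.2]) hb
  have h1 : 0 ≤ s * a := mul_nonneg hs.1.le ha
  have hov : overlapSq hA' hB' i j = ‖o‖ ^ 2 := rfl
  rw [hov]
  set p := (1 - s) * b + s * a with hp
  rcases (add_nonneg h0 h1).eq_or_lt with hp0 | hp0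
  · have hb0 : b = 0 := by
      have : (1 - s) * b = 0 := by linarith
      rcases mul_eq_zero.1 this with h | h
      · linarith [hs.2]
      · exact h
    have ha0 : a = 0 := by
      have : s * a = 0 := by linarith
      rcases mul_eq_zero.1 this with h | h
      · linarith [hs.1]
      · exact h
    simp [hp, ha0, hb0]
  · have hre : |(star w * o).re| ≤ ‖w‖ * ‖o‖ := by
      simpa using Complex.abs_re_le_norm (star w * o)
    have key : 2 * (star w * o).re * (a - b) ≤ 2 * (‖w‖ * ‖o‖) * |a - b| := by
      have := mul_le_mul_of_nonneg_right hre (abs_nonneg (a - b))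
      rw [← abs_mul] at this
      linarith [le_abs_self ((star w * o).re * (a - b))]
    rw [← hp] at hp0
    have : ‖o‖ ^ 2 * ((a - b) ^ 2 / p) = p * (‖o‖ * |a - b| / p) ^ 2 := by
      rw [← sq_abs (a - b)]
      field_simp
    rw [this]
    have h2 : p * (‖o‖ * |a - b| / p) ^ 2 + p * ‖w‖ ^ 2 - 2 * (‖w‖ * ‖o‖) * |a - b| =
        p * (‖o‖ * |a - b| / p - ‖w‖) ^ 2 := by
      field_simp
      ring
    nlinarith [mul_nonneg hp0.le (sq_nonneg (‖o‖ * |a - b| / p - ‖w‖))]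

/-- The maximizer is read off from the completed square: entrywise it is the overlap times `(a - b)
/ p`, with `p` the denominator. Where `p = 0`, division by zero makes both sides vanish. -/
lemma exists_variationalForm_eq (hA : A.PosSemidef) (hB : B.PosSemidef) (s : ℝ) :
    ∃ W, variationalForm A B s W = resolventForm hA.isHermitian hB.isHermitian s := by
  set hA' := hA.isHermitian
  set hB' := hB.isHermitian
  refine ⟨eigenMatrix hA' * Matrix.of (fun i j => ((eigenMatrix hA')ᴴ * eigenMatrix hB') i j *
    (((hA'.eigenvalues i - hB'.eigenvalues j) /
      ((1 - s) * hB'.eigenvalues j + s * hA'.eigenvalues i) : ℝ) : ℂ)) * (eigenMatrix hB')ᴴ, ?_⟩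
  rw [variationalForm_eq_sum]
  refine sum_congr rfl fun i _ => sum_congr rfl fun j _ => ?_
  have hov : overlapSq hA' hB' i j = ‖((eigenMatrix hA')ᴴ * eigenMatrix hB') i j‖ ^ 2 := rfl
  rw [hov, of_apply]
  set o := ((eigenMatrix hA')ᴴ * eigenMatrix hB') i j with ho
  set c := hA'.eigenvalues i - hB'.eigenvalues j
  set p := (1 - s) * hB'.eigenvalues j + s * hA'.eigenvalues i
  have h1 : (star (o * ((c / p : ℝ) : ℂ)) * o).re = ‖o‖ ^ 2 * (c / p) := by
    rw [star_mul', mul_right_comm, star_mul_eq_norm_sq, Complex.star_def, Complex.conj_ofReal,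
      ← Complex.ofReal_mul, Complex.ofReal_re]
  rw [h1, norm_mul, Complex.norm_real, mul_pow, Real.norm_eq_abs, sq_abs]
  by_cases hp : p = 0
  · simp [hp]
  · field_simp
    ring

/-- The scalar formula is summed over pairs of eigenvectors. The support condition `hAB` supplies
its side condition wherever the overlap is nonzero. -/
lemma relEntropy_eq_integral (hA : A.PosSemidef) (hB : B.PosSemidef)
    (hAB : ∀ i j, hB.isHermitian.eigenvalues j = 0 →
      overlapSq hA.isHermitian hB.isHermitian i j * hA.isHermitian.eigenvalues i = 0) :
    IntervalIntegrable (fun s : ℝ => (1 - s) * resolventForm hA.isHermitian hB.isHermitian s)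
      MeasureTheory.volume 0 1 ∧
    ∫ s in (0 : ℝ)..1, (1 - s) * resolventForm hA.isHermitian hB.isHermitian s =
      relEntropy hA.isHermitian hB.isHermitian := by
  set hA' := hA.isHermitian
  set hB' := hB.isHermitian
  have hterm : ∀ i j, IntervalIntegrable (fun s : ℝ => overlapSq hA' hB' i j *
        ((1 - s) * ((hA'.eigenvalues i - hB'.eigenvalues j) ^ 2 /
          ((1 - s) * hB'.eigenvalues j + s * hA'.eigenvalues i)))) MeasureTheory.volume 0 1 ∧
      ∫ s in (0 : ℝ)..1, overlapSq hA' hB' i j *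
        ((1 - s) * ((hA'.eigenvalues i - hB'.eigenvalues j) ^ 2 /
          ((1 - s) * hB'.eigenvalues j + s * hA'.eigenvalues i))) = overlapSq hA' hB' i j *
    (hA'.eigenvalues i * Real.log (hA'.eigenvalues i) -
      hA'.eigenvalues i * Real.log (hB'.eigenvalues j) - hA'.eigenvalues i +
        hB'.eigenvalues j) := fun i j => by
    by_cases ho : overlapSq hA' hB' i j = 0
    · simp [ho]
    · have := relativeEntropy_integral (hA.eigenvalues_nonneg i) (hB.eigenvalues_nonneg j)
        (fun hb => (mul_eq_zero.1 (hAB i j hb)).resolve_left ho)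
      exact ⟨this.1.const_mul _, by rw [intervalIntegral.integral_const_mul, this.2]⟩
  have hsum : (fun s : ℝ => (1 - s) * resolventForm hA' hB' s) = fun s => ∑ i, ∑ j,
      overlapSq hA' hB' i j * ((1 - s) * ((hA'.eigenvalues i - hB'.eigenvalues j) ^ 2 /
          ((1 - s) * hB'.eigenvalues j + s * hA'.eigenvalues i))) := by
    funext s
    simp only [resolventForm, mul_sum]
    refine sum_congr rfl fun i _ => sum_congr rfl fun j _ => ?_
    ring
  have hi : ∀ i, IntervalIntegrable (fun s : ℝ => ∑ j, overlapSq hA' hB' i j *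
        ((1 - s) * ((hA'.eigenvalues i - hB'.eigenvalues j) ^ 2 /
          ((1 - s) * hB'.eigenvalues j + s * hA'.eigenvalues i)))) MeasureTheory.volume 0 1 :=
    fun i => by
      simpa only [Finset.sum_fn] using
        IntervalIntegrable.sum univ fun j _ => (hterm i j).1
  rw [hsum]
  refine ⟨by simpa only [Finset.sum_fn] using IntervalIntegrable.sum univ fun i _ => hi i, ?_⟩
  rw [intervalIntegral.integral_finsetSum fun i _ => hi i, relEntropy]
  refine sum_congr rfl fun i _ => ?_
  rw [intervalIntegral.integral_finsetSum fun j _ => (hterm i j).1]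
  exact sum_congr rfl fun j _ => (hterm i j).2

end RelativeEntropy

/-! ### Channels and the Kadison-Schwarz inequality. -/

section Kraus

variable {n m κ : Type*} [Fintype n] [Fintype m] [Fintype κ]

/-- The completely positive map with Kraus operators `K`. -/
noncomputable def krausMap (K : κ → Matrix m n ℂ) (X : Matrix n n ℂ) : Matrix m m ℂ :=
  ∑ y, K y * X * (K y)ᴴ

/-- The Hilbert-Schmidt adjoint of `krausMap K`. -/
noncomputable def krausDual (K : κ → Matrix m n ℂ) (W : Matrix m m ℂ) : Matrix n n ℂ :=
  ∑ y, (K y)ᴴ * W * K y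

omit [Fintype n] in
lemma krausDual_conjTranspose (K : κ → Matrix m n ℂ) (W : Matrix m m ℂ) :
    krausDual K Wᴴ = (krausDual K W)ᴴ := by
  simp only [krausDual, conjTranspose_sum, conjTranspose_mul, conjTranspose_conjTranspose,
    Matrix.mul_assoc]

lemma trace_mul_krausMap (K : κ → Matrix m n ℂ) (W : Matrix m m ℂ) (X : Matrix n n ℂ) :
    (W * krausMap K X).trace = (krausDual K W * X).trace := by
  simp only [krausMap, krausDual, Matrix.mul_sum, Matrix.sum_mul, trace_sum]
  refine sum_congr rfl fun y _ => ?_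
  rw [← Matrix.mul_assoc, trace_mul_comm]
  simp only [Matrix.mul_assoc]

/-- The Kadison-Schwarz inequality for the adjoint of a trace-preserving completely positive map,
tested on a positive matrix. -/
lemma trace_krausDual_le [DecidableEq n] {K : κ → Matrix m n ℂ} (hK : ∑ y, (K y)ᴴ * K y = 1)
    {A : Matrix n n ℂ} (hA : A.PosSemidef) (W : Matrix m m ℂ) :
    ((krausDual K W)ᴴ * A * krausDual K W).trace.re ≤ (Wᴴ * krausMap K A * W).trace.re := by
  set W' := krausDual K W with hW'
  have hWs : ∑ y, (K y)ᴴ * Wᴴ * K y = W'ᴴ := krausDual_conjTranspose K W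
  -- By `hK`, expanding this sum of nonnegative traces gives exactly the right side minus the left:
  -- each cross term equals `-Tr (W'ᴴ A W')`, and the last term cancels one of the two.
  have h0 : 0 ≤ (∑ y, (((K y)ᴴ * W - W' * (K y)ᴴ)ᴴ * A * ((K y)ᴴ * W - W' * (K y)ᴴ)).trace).re := by
    rw [Complex.re_sum]
    refine sum_nonneg fun y _ => ?_
    exact (Complex.nonneg_iff.1 (hA.conjTranspose_mul_mul_same _).trace_nonneg).1
  have e : ∀ y, (((K y)ᴴ * W - W' * (K y)ᴴ)ᴴ * A * ((K y)ᴴ * W - W' * (K y)ᴴ)).trace =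
      (Wᴴ * (K y * A * (K y)ᴴ) * W).trace - (((K y)ᴴ * Wᴴ * K y) * A * W').trace -
        (W'ᴴ * A * ((K y)ᴴ * W * K y)).trace + (W'ᴴ * A * W' * ((K y)ᴴ * K y)).trace := fun y => by
    have e2 : (Wᴴ * (K y * (A * (W' * (K y)ᴴ)))).trace =
        ((K y)ᴴ * (Wᴴ * (K y * (A * W')))).trace := by
      rw [trace_mul_comm ((K y)ᴴ)]; simp only [Matrix.mul_assoc]
    have e3 : (K y * (W'ᴴ * (A * ((K y)ᴴ * W)))).trace =
        (W'ᴴ * (A * ((K y)ᴴ * (W * K y)))).trace := by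
      rw [trace_mul_comm (K y)]; simp only [Matrix.mul_assoc]
    have e4 : (K y * (W'ᴴ * (A * (W' * (K y)ᴴ)))).trace =
        (W'ᴴ * (A * (W' * ((K y)ᴴ * K y)))).trace := by
      rw [trace_mul_comm (K y)]; simp only [Matrix.mul_assoc]
    simp only [conjTranspose_sub, conjTranspose_mul, conjTranspose_conjTranspose, Matrix.sub_mul,
      Matrix.mul_sub,
      Matrix.mul_assoc, trace_sub, e2, e3, e4]
    ring
  simp only [e, sum_add_distrib, sum_sub_distrib, ← trace_sum, ← Matrix.mul_sum, ← Matrix.sum_mul,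
    hWs, hK] at h0
  rw [← krausMap, ← krausDual, ← hW', mul_one] at h0
  simp only [Complex.add_re, Complex.sub_re] at h0
  linarith

/-- Duality preserves the linear term. The quadratic terms enter with negative sign and are compared
by Kadison-Schwarz, for `A` with `W` and for `B` with `Wᴴ`. -/
lemma variationalForm_krausMap_le [DecidableEq n] [DecidableEq m]
    {K : κ → Matrix m n ℂ} (hK : ∑ y, (K y)ᴴ * K y = 1)
    {A B : Matrix n n ℂ} (hA : A.PosSemidef) (hB : B.PosSemidef) {s : ℝ} (hs : s ∈ Set.Ioo 0 1)
    (W : Matrix m m ℂ) :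
    variationalForm (krausMap K A) (krausMap K B) s W ≤
      variationalForm A B s (krausDual K W) := by
  have h1 : (Wᴴ * (krausMap K A - krausMap K B)).trace =
      ((krausDual K W)ᴴ * (A - B)).trace := by
    rw [Matrix.mul_sub, Matrix.mul_sub, trace_sub, trace_sub,
      trace_mul_krausMap, trace_mul_krausMap,
      krausDual_conjTranspose]
  have h2 := trace_krausDual_le hK hA W
  have h3 := trace_krausDual_le hK hB Wᴴ
  rw [krausDual_conjTranspose, conjTranspose_conjTranspose, conjTranspose_conjTranspose] at h3
  rw [variationalForm, variationalForm, h1]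
  have h4 := mul_le_mul_of_nonneg_left h2 hs.1.le
  have h5 := mul_le_mul_of_nonneg_left h3 (sub_nonneg.2 hs.2.le)
  linarith

lemma posSemidef_krausMap (K : κ → Matrix m n ℂ) {A : Matrix n n ℂ} (hA : A.PosSemidef) :
    (krausMap K A).PosSemidef :=
  posSemidef_sum _ fun y _ => hA.mul_mul_conjTranspose_same (K y)

end Kraus

/-! ### Monotonicity when relative entropy is a difference of entropies. -/

section EntropyPair

variable {n : Type*} [Fintype n] [DecidableEq n] {A B : Matrix n n ℂ}

/-- `A` and `B` agree on the algebra generated by `B`, as when `B` is the image of `A` under a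
trace-preserving conditional expectation. -/
def IsEntropyPair (A B : Matrix n n ℂ) : Prop :=
  ∀ k : ℕ, (A * B ^ k).trace = (B * B ^ k).trace

/-- This is `Tr A f(B) = Tr B f(B)` for arbitrary `f`: the diagonal of `A` in the eigenbasis of `B`
and the eigenvalues of `B` are weights with the same moments. -/
lemma IsEntropyPair.sum_apply (hA : A.IsHermitian) (hB : B.IsHermitian) (h : IsEntropyPair A B)
    (f : ℝ → ℝ) :
    ∑ j, (∑ i, overlapSq hA hB i j * hA.eigenvalues i) * f (hB.eigenvalues j) =
      ∑ j, hB.eigenvalues j * f (hB.eigenvalues j) := by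
  refine sum_mul_apply_eq_of_moments (fun k => ?_) f
  have h1 := h k
  rw [trace_mul_pow hB, ← pow_succ', trace_pow hB] at h1
  simp only [eigenMatrix_conj_apply_self hA hB] at h1
  simp only [pow_succ'] at h1
  exact_mod_cast h1

lemma IsEntropyPair.support (hA : A.PosSemidef) (hB : B.PosSemidef) (h : IsEntropyPair A B)
    (i j : n) (hj : hB.isHermitian.eigenvalues j = 0) :
    overlapSq hA.isHermitian hB.isHermitian i j * hA.isHermitian.eigenvalues i = 0 := by
  -- Testing on the indicator of the origin shows that `A` has no mass on the kernel of `B`; the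
  -- nonnegative terms then vanish one by one.
  have h1 := h.sum_apply hA.isHermitian hB.isHermitian (fun x => if x = 0 then 1 else 0)
  have hr : ∑ j, hB.isHermitian.eigenvalues j *
      (if hB.isHermitian.eigenvalues j = 0 then (1 : ℝ) else 0) = 0 :=
    sum_eq_zero fun j _ => by split_ifs with h <;> simp [h]
  have hn : ∀ i j, 0 ≤ overlapSq hA.isHermitian hB.isHermitian i j *
      hA.isHermitian.eigenvalues i := fun i j =>
    mul_nonneg (overlapSq_nonneg _ _ _ _) (hA.eigenvalues_nonneg i)
  rw [hr, sum_eq_zero_iff_of_nonneg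
    (fun j _ => mul_nonneg (sum_nonneg fun i _ => hn i j) (by split_ifs <;> norm_num))] at h1
  have h2 := h1 j (mem_univ j)
  rw [if_pos hj, mul_one, sum_eq_zero_iff_of_nonneg (fun i _ => hn i j)] at h2
  exact h2 i (mem_univ i)

/-- The test function `log` turns `Tr A log B` into `Tr B log B`, and the constant `1` cancels the
traces. -/
lemma IsEntropyPair.relEntropy_eq (hA : A.IsHermitian) (hB : B.IsHermitian)
    (h : IsEntropyPair A B) : relEntropy hA hB = vonNeumann hB - vonNeumann hA := by
  have hl := h.sum_apply hA hB Real.log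
  have h1 := h.sum_apply hA hB (fun _ => 1)
  simp only [mul_one] at h1
  have ha : ∑ i, ∑ j, overlapSq hA hB i j * (hA.eigenvalues i * Real.log (hA.eigenvalues i)) =
      ∑ i, hA.eigenvalues i * Real.log (hA.eigenvalues i) :=
    sum_congr rfl fun i _ => by rw [← sum_mul, sum_overlapSq_right, one_mul]
  have hb : ∑ i, ∑ j, overlapSq hA hB i j * hB.eigenvalues j = ∑ j, hB.eigenvalues j := by
    rw [sum_comm]
    exact sum_congr rfl fun j _ => by rw [← sum_mul, sum_overlapSq_left, one_mul]
  have hab : ∑ i, ∑ j, overlapSq hA hB i j *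
      (hA.eigenvalues i * Real.log (hB.eigenvalues j)) =
        ∑ j, hB.eigenvalues j * Real.log (hB.eigenvalues j) := by
    rw [← hl, sum_comm]
    refine sum_congr rfl fun j _ => ?_
    rw [sum_mul]
    exact sum_congr rfl fun i _ => by ring
  rw [sum_comm] at h1
  simp only [relEntropy, mul_add, mul_sub, sum_add_distrib, sum_sub_distrib, ha, hb, hab, h1,
    vonNeumann, Real.negMulLog, neg_mul, sum_neg_distrib]
  ring

/-- Monotonicity of the relative entropy under trace-preserving completely positive maps, expressed
through entropies. -/
theorem IsEntropyPair.vonNeumann_sub_le {m κ : Type*} [Fintype m] [DecidableEq m] [Fintype κ]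
    {K : κ → Matrix m n ℂ} (hK : ∑ y, (K y)ᴴ * K y = 1) (hA : A.PosSemidef) (hB : B.PosSemidef)
    (h : IsEntropyPair A B) {A' B' : Matrix m m ℂ} (hA' : A'.PosSemidef) (hB' : B'.PosSemidef)
    (h' : IsEntropyPair A' B') (eA : krausMap K A = A') (eB : krausMap K B = B') :
    vonNeumann hB'.isHermitian - vonNeumann hA'.isHermitian ≤
      vonNeumann hB.isHermitian - vonNeumann hA.isHermitian := by
  rw [← h.relEntropy_eq, ← h'.relEntropy_eq]
  obtain ⟨i1, e1⟩ := relEntropy_eq_integral hA hB (h.support hA hB)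
  obtain ⟨i2, e2⟩ := relEntropy_eq_integral hA' hB' (h'.support hA' hB')
  rw [← e1, ← e2]
  refine intervalIntegral.integral_mono_on_of_le_Ioo zero_le_one i2 i1 fun s hs => ?_
  refine mul_le_mul_of_nonneg_left ?_ (sub_nonneg.2 hs.2.le)
  obtain ⟨W, hW⟩ := exists_variationalForm_eq hA' hB' s
  rw [← hW, ← eA, ← eB]
  exact (variationalForm_krausMap_le hK hA hB hs W).trans (variationalForm_le hA hB hs _)

end EntropyPair

/-! ### Dephasing and partial mixing as entropy pairs. -/

section Blocks

lemma posSemidef_blockDiag {m o : Type*} {A : Matrix (m × o) (m × o) ℂ} (hA : A.PosSemidef)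
    (i : o) : (A.blockDiag i).PosSemidef :=
  hA.submatrix fun a => (a, i)

section Trace

variable {m o : Type*} [Fintype m] [Fintype o]

lemma trace_mul_blockDiagonal [DecidableEq o] (A : Matrix (m × o) (m × o) ℂ)
    (M : o → Matrix m m ℂ) :
    (A * blockDiagonal M).trace = ∑ i, (A.blockDiag i * M i).trace := by
  simp only [trace, Matrix.diag, mul_apply, Fintype.sum_prod_type, blockDiagonal_apply,
    blockDiag_apply, mul_ite, mul_zero, sum_ite_eq', mem_univ, if_true]
  rw [sum_comm]

lemma posSemidef_blockDiagonal [DecidableEq o] {M : o → Matrix m m ℂ} (hM : ∀ i, (M i).PosSemidef) :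
    (blockDiagonal M).PosSemidef := by
  refine PosSemidef.of_dotProduct_mulVec_nonneg ?_ fun x => ?_
  · rw [IsHermitian, blockDiagonal_conjTranspose]
    exact congrArg _ (funext fun i => (hM i).isHermitian)
  · have : star x ⬝ᵥ (blockDiagonal M *ᵥ x) =
        ∑ i, star (fun a => x (a, i)) ⬝ᵥ (M i *ᵥ fun a => x (a, i)) := by
      simp only [dotProduct, mulVec, Fintype.sum_prod_type, blockDiagonal_apply, ite_mul, zero_mul,
        sum_ite_eq, mem_univ, if_true, Pi.star_apply]
      rw [sum_comm]
    rw [this]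
    exact sum_nonneg fun i _ => (hM i).dotProduct_mulVec_nonneg _

omit [Fintype m] in
lemma posSemidef_sum_blockDiag {A : Matrix (m × o) (m × o) ℂ} (hA : A.PosSemidef) :
    (∑ i, A.blockDiag i).PosSemidef :=
  posSemidef_sum _ fun i _ => posSemidef_blockDiag hA i

lemma trace_sum_blockDiag (A : Matrix (m × o) (m × o) ℂ) :
    (∑ i, A.blockDiag i).trace = A.trace := by
  rw [trace_sum]
  exact (Fintype.sum_prod_type_right (fun x => A x x)).symm

end Trace

variable {m o : Type*} [Fintype m] [DecidableEq m] [Fintype o] [DecidableEq o]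

lemma isEntropyPair_blockDiag (A : Matrix (m × o) (m × o) ℂ) :
    IsEntropyPair A (blockDiagonal A.blockDiag) := fun k => by
  rw [← blockDiagonal_pow, trace_mul_blockDiagonal, trace_mul_blockDiagonal,
    blockDiag_blockDiagonal]

/-- The product of the partial trace over the second factor with the maximally mixed state. -/
noncomputable def mixRight (A : Matrix (m × o) (m × o) ℂ) : Matrix (m × o) (m × o) ℂ :=
  blockDiagonal fun _ => ((Fintype.card o : ℝ)⁻¹ : ℂ) • ∑ i, A.blockDiag i

omit [DecidableEq m] in
lemma posSemidef_mixRight {A : Matrix (m × o) (m × o) ℂ} (hA : A.PosSemidef) :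
    (mixRight A).PosSemidef :=
  posSemidef_blockDiagonal fun _ => (posSemidef_sum_blockDiag hA).smul (by positivity)

lemma isEntropyPair_mixRight [Nonempty o] (A : Matrix (m × o) (m × o) ℂ) :
    IsEntropyPair A (mixRight A) := fun k => by
  have hd : (Fintype.card o : ℂ) ≠ 0 := by exact_mod_cast Fintype.card_ne_zero
  rw [mixRight, ← blockDiagonal_pow, trace_mul_blockDiagonal, trace_mul_blockDiagonal,
    blockDiag_blockDiagonal]
  simp only [Pi.pow_apply, smul_mul_assoc, trace_smul, sum_const, card_univ]
  rw [← trace_sum, ← sum_mul]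
  simp [hd]

lemma vonNeumann_blockDiagonal {M : o → Matrix m m ℂ} (hM : ∀ i, (M i).IsHermitian)
    (h : (blockDiagonal M).IsHermitian) : vonNeumann h = ∑ i, vonNeumann (hM i) := by
  have := vonNeumann_eq_sum h hM (fun _ => 1) (fun _ => 1) fun k => by
    rw [← blockDiagonal_pow, trace_blockDiagonal]
    simp
  simpa using this

lemma vonNeumann_mixRight [Nonempty o] {A : Matrix (m × o) (m × o) ℂ} (hA : A.PosSemidef) :
    vonNeumann (posSemidef_mixRight hA).isHermitian =
      vonNeumann (posSemidef_sum_blockDiag hA).isHermitian +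
        Real.log (Fintype.card o) * A.trace.re := by
  have hd : (Fintype.card o : ℝ) ≠ 0 := by exact_mod_cast Fintype.card_ne_zero
  have := vonNeumann_eq_sum (κ := Unit) (m := fun _ => m) (posSemidef_mixRight hA).isHermitian
    (B := fun _ => ∑ i, A.blockDiag i)
    (fun _ => (posSemidef_sum_blockDiag hA).isHermitian)
    (fun _ => (Fintype.card o : ℝ)) (fun _ => (Fintype.card o : ℝ)⁻¹) fun k => by
      rw [mixRight, ← blockDiagonal_pow, trace_blockDiagonal]
      simp [smul_pow, mul_assoc]
  rw [this]
  simp only [trace_sum_blockDiag, univ_unique, sum_const, card_singleton, one_smul,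
    Real.negMulLog, Real.log_inv]
  field_simp

end Blocks

section Reindex

variable {m n : Type*} [Fintype m] [DecidableEq m] [Fintype n] [DecidableEq n]

lemma trace_submatrix_pow (A : Matrix n n ℂ) (e : m ≃ n) (k : ℕ) :
    ((A.submatrix e e) ^ k).trace = (A ^ k).trace := by
  have h : (A.submatrix e e) ^ k = (A ^ k).submatrix e e := by
    induction k with
    | zero => simp
    | succ k ih => rw [pow_succ, ih, pow_succ, submatrix_mul_equiv]
  rw [h]
  exact e.sum_comp fun i => (A ^ k) i i

lemma vonNeumann_submatrix {A : Matrix n n ℂ} (hA : A.IsHermitian) (e : m ≃ n)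
    (h : (A.submatrix e e).IsHermitian) : vonNeumann h = vonNeumann hA :=
  vonNeumann_eq_of_trace_pow h hA fun k => trace_submatrix_pow A e (k + 1)

end Reindex

section PartialTrace

variable {κ m n : Type*} [Fintype κ] [Fintype n] [DecidableEq n]

/-- The Kraus operators of the partial trace over `κ`, for a space labelled by `n ≃ κ × m`. -/
noncomputable def partialTraceKraus (e : κ × m ≃ n) (b : κ) : Matrix m n ℂ :=
  (1 : Matrix n n ℂ).submatrix (fun p => e (b, p)) id

lemma sum_partialTraceKraus [Fintype m] (e : κ × m ≃ n) :
    ∑ b, (partialTraceKraus e b)ᴴ * partialTraceKraus e b = 1 := by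
  ext q q'
  rw [Matrix.sum_apply]
  simp only [mul_apply, partialTraceKraus, conjTranspose_apply, submatrix_apply]
  change ∑ b, ∑ p, star ((1 : Matrix n n ℂ) (e (b, p)) q) * (1 : Matrix n n ℂ) (e (b, p)) q' = _
  rw [← Fintype.sum_prod_type' (f := fun b p => star ((1 : Matrix n n ℂ) (e (b, p)) q) *
    (1 : Matrix n n ℂ) (e (b, p)) q'), e.sum_comp (fun x => star ((1 : Matrix n n ℂ) x q) *
    (1 : Matrix n n ℂ) x q')]
  simp [one_apply, eq_comm]

lemma krausMap_partialTraceKraus (e : κ × m ≃ n) (X : Matrix n n ℂ) :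
    krausMap (partialTraceKraus e) X =
      ∑ b, X.submatrix (fun p => e (b, p)) (fun p => e (b, p)) := by
  refine sum_congr rfl fun b _ => ?_
  ext p q
  simp [partialTraceKraus, mul_apply, one_apply]

end PartialTrace

/-! ### Strong subadditivity. -/

section StrongSubadditivity

variable {b m o : Type*} [Fintype b] [DecidableEq b] [Fintype m] [DecidableEq m] [Fintype o]
  [DecidableEq o]

/-- The partial trace over the first of three tensor factors. -/
noncomputable def traceFst (A : Matrix ((b × m) × o) ((b × m) × o) ℂ) : Matrix (m × o) (m × o) ℂ :=
  krausMap (partialTraceKraus (Equiv.prodAssoc b m o).symm) A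

lemma traceFst_eq_sum (A : Matrix ((b × m) × o) ((b × m) × o) ℂ) :
    traceFst A = ∑ k, A.submatrix (fun p => ((k, p.1), p.2)) (fun p => ((k, p.1), p.2)) :=
  krausMap_partialTraceKraus _ A

lemma posSemidef_traceFst {A : Matrix ((b × m) × o) ((b × m) × o) ℂ} (hA : A.PosSemidef) :
    (traceFst A).PosSemidef :=
  posSemidef_krausMap _ hA

lemma trace_traceFst (A : Matrix ((b × m) × o) ((b × m) × o) ℂ) :
    (traceFst A).trace = A.trace := by
  rw [traceFst_eq_sum, trace_sum]
  simp only [trace, Matrix.diag, submatrix_apply, Fintype.sum_prod_type]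

/-- Strong subadditivity of the von Neumann entropy. -/
theorem strong_subadditivity [Nonempty o] {A : Matrix ((b × m) × o) ((b × m) × o) ℂ}
    (hA : A.PosSemidef) :
    vonNeumann (posSemidef_sum_blockDiag (posSemidef_traceFst hA)).isHermitian +
        vonNeumann hA.isHermitian ≤
      vonNeumann (posSemidef_traceFst hA).isHermitian +
        vonNeumann (posSemidef_sum_blockDiag hA).isHermitian := by
  -- Tracing out the first factor commutes with mixing the last one. The two `log (card o)` terms
  -- cancel because the trace is preserved.
  have h := (isEntropyPair_mixRight A).vonNeumann_sub_le
    (sum_partialTraceKraus (Equiv.prodAssoc b m o).symm) hA (posSemidef_mixRight hA)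
    (posSemidef_traceFst hA) (posSemidef_mixRight (posSemidef_traceFst hA))
    (isEntropyPair_mixRight (traceFst A)) rfl (by
      rw [← traceFst, traceFst_eq_sum, traceFst_eq_sum, mixRight, mixRight]
      ext ⟨e, a⟩ ⟨e', a'⟩
      simp only [Matrix.sum_apply, submatrix_apply, blockDiagonal_apply, Matrix.smul_apply,
        blockDiag_apply]
      split_ifs with h
      · rw [← smul_sum, sum_comm]
      · simp)
  rw [vonNeumann_mixRight hA, vonNeumann_mixRight (posSemidef_traceFst hA), trace_traceFst] at h
  linarith

end StrongSubadditivity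

/-! ### Entropic uncertainty with quantum side information. -/

section Uncertainty

variable {m o : Type*} [Fintype m] [DecidableEq m] [Fintype o]

/-- The contraction of the second tensor factor with the vector `u`. -/
noncomputable def contract (u : o → ℂ) : Matrix m (m × o) ℂ :=
  of fun e q => if e = q.1 then u q.2 else 0

/-- The unnormalized state of the first factor after the second one was found in the state with
conjugate vector `u`. -/
noncomputable def conditionalBlock (u : o → ℂ) (A : Matrix (m × o) (m × o) ℂ) : Matrix m m ℂ :=
  (contract u : Matrix m (m × o) ℂ) * A * (contract u : Matrix m (m × o) ℂ)ᴴ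

lemma posSemidef_conditionalBlock (u : o → ℂ) {A : Matrix (m × o) (m × o) ℂ}
    (hA : A.PosSemidef) : (conditionalBlock u A).PosSemidef :=
  hA.mul_mul_conjTranspose_same _

lemma conditionalBlock_apply (u : o → ℂ) (A : Matrix (m × o) (m × o) ℂ) (e e' : m) :
    conditionalBlock u A e e' = ∑ c, ∑ c', u c * A (e, c) (e', c') * star (u c') := by
  simp only [conditionalBlock, contract, mul_apply, conjTranspose_apply, of_apply,
    Fintype.sum_prod_type, ite_mul, zero_mul, apply_ite star, star_zero, mul_ite, mul_zero]
  rw [sum_comm (t := univ (α := o))]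
  simp only [sum_ite_irrel, sum_const_zero, sum_ite_eq, mem_univ, if_true, sum_mul]
  rw [sum_comm]

/-- The Kraus operators of the measurement of the second factor in the basis conjugate to the
columns of `U`, whose outcome is recorded in that factor. -/
noncomputable def measureKraus [DecidableEq o] (U : Matrix o o ℂ) (i : o) :
    Matrix (m × o) (m × o) ℂ :=
  of fun p q => if p.1 = q.1 ∧ p.2 = i then U q.2 i else 0

lemma sum_measureKraus [DecidableEq o] {U : Matrix o o ℂ} (hU : U * Uᴴ = 1) :
    ∑ i, (measureKraus U i)ᴴ * measureKraus U i = (1 : Matrix (m × o) (m × o) ℂ) := by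
  ext ⟨e, c⟩ ⟨e', c'⟩
  have h1 := congrFun (congrFun hU c') c
  simp only [mul_apply, conjTranspose_apply] at h1
  simp only [Matrix.sum_apply, mul_apply, measureKraus, conjTranspose_apply, of_apply,
    Fintype.sum_prod_type, apply_ite star, star_zero, ite_mul, zero_mul, mul_ite, mul_zero, ite_and]
  have h2 : ∑ x, (starRingEnd ℂ) (U c x) * U c' x = (1 : Matrix o o ℂ) c' c := by
    rw [← h1]
    exact sum_congr rfl fun i _ => mul_comm _ _
  simp [h2, one_apply, Prod.ext_iff, ite_and, eq_comm]

lemma krausMap_measureKraus [DecidableEq o] (U : Matrix o o ℂ) (A : Matrix (m × o) (m × o) ℂ) :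
    krausMap (measureKraus U) A = blockDiagonal fun i => conditionalBlock (fun c => U c i) A := by
  ext ⟨e, a⟩ ⟨e', a'⟩
  rw [blockDiagonal_apply, conditionalBlock_apply, krausMap]
  simp only [Matrix.sum_apply, mul_apply, measureKraus, conjTranspose_apply, of_apply,
    Fintype.sum_prod_type, ite_and]
  by_cases h : a = a'
  · subst h
    simp [apply_ite (starRingEnd ℂ), sum_ite_irrel, sum_mul]
    rw [sum_comm]
  · simp [apply_ite (starRingEnd ℂ), sum_ite_irrel, h]

lemma sum_conditionalBlock [DecidableEq o] {U : Matrix o o ℂ} (hU : U * Uᴴ = 1)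
    (A : Matrix (m × o) (m × o) ℂ) :
    ∑ i, conditionalBlock (fun c => U c i) A = ∑ i, A.blockDiag i := by
  ext e e'
  simp only [Matrix.sum_apply, conditionalBlock_apply, blockDiag_apply]
  rw [sum_comm]
  refine sum_congr rfl fun c _ => ?_
  rw [sum_comm]
  have h1 : ∀ c', ∑ i, U c i * A (e, c) (e', c') * star (U c' i) =
      A (e, c) (e', c') * (1 : Matrix o o ℂ) c c' := fun c' => by
    rw [← hU, mul_apply, mul_sum]
    exact sum_congr rfl fun i _ => by rw [conjTranspose_apply]; ring
  simp only [h1, one_apply, mul_ite, mul_one, mul_zero, sum_ite_eq, mem_univ, if_true]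

/-- The entropic uncertainty relation for two mutually unbiased measurements with quantum side
information. -/
theorem uncertainty_relation [DecidableEq o] [Nonempty o] {U : Matrix o o ℂ} (hU : U * Uᴴ = 1)
    (hb : ∀ c i, ‖U c i‖ ^ 2 = (Fintype.card o : ℝ)⁻¹) {A : Matrix (m × o) (m × o) ℂ}
    (hA : A.PosSemidef) :
    vonNeumann hA.isHermitian + vonNeumann (posSemidef_sum_blockDiag hA).isHermitian +
        Real.log (Fintype.card o) * A.trace.re ≤
      ∑ i, vonNeumann (posSemidef_blockDiag hA i).isHermitian +
        ∑ i, vonNeumann (posSemidef_conditionalBlock (fun c => U c i) hA).isHermitian := by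
  have hD := posSemidef_blockDiagonal fun i => posSemidef_blockDiag hA i
  have hT : (blockDiagonal fun i => conditionalBlock (fun c => U c i) A).PosSemidef :=
    posSemidef_blockDiagonal fun i => posSemidef_conditionalBlock _ hA
  -- Measuring does not change the reduced state of the first factor, so the measured state forms an
  -- entropy pair with `mixRight A` as well.
  have hmix : mixRight (blockDiagonal fun i => conditionalBlock (fun c => U c i) A) =
      mixRight A := by
    rw [mixRight, mixRight, blockDiag_blockDiagonal, sum_conditionalBlock hU]
  -- `A` and its dephasing are both measured in the second basis. By unbiasedness `hb`, each outcome
  -- of the dephased state has the same conditional block, so its image is `mixRight A`.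
  have h := (isEntropyPair_blockDiag A).vonNeumann_sub_le (sum_measureKraus hU) hA hD hT
    (posSemidef_mixRight hA) (hmix ▸ isEntropyPair_mixRight _) (krausMap_measureKraus U A) (by
      rw [krausMap_measureKraus, mixRight]
      congr 1
      funext i
      ext e e'
      rw [conditionalBlock_apply, Matrix.smul_apply, Matrix.sum_apply, smul_sum]
      refine sum_congr rfl fun c _ => ?_
      have h1 : U c i * star (U c i) = ((Fintype.card o : ℝ)⁻¹ : ℂ) := by
        rw [mul_star_eq_norm_sq, hb]; simp
      simp only [blockDiagonal_apply, mul_ite, ite_mul, mul_zero, zero_mul, sum_ite_eq, mem_univ,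
        if_true]
      rw [mul_right_comm, h1, smul_eq_mul])
  rw [vonNeumann_mixRight hA,
    vonNeumann_blockDiagonal fun i => (posSemidef_blockDiag hA i).isHermitian,
    vonNeumann_blockDiagonal fun i => (posSemidef_conditionalBlock _ hA).isHermitian] at h
  linarith

end Uncertainty

section Diagonal

variable {n : Type*} [Fintype n] [DecidableEq n]

lemma vonNeumann_diagonal (w : n → ℝ) (h : (diagonal fun i => (w i : ℂ)).IsHermitian) :
    vonNeumann h = ∑ i, Real.negMulLog (w i) := by
  have := sum_mul_apply_eq_of_pos_moments (w := fun _ => (1 : ℝ)) (a := h.eigenvalues)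
    (c := fun _ => (1 : ℝ)) (b := w) (fun k => by
      have := trace_pow h (k + 1)
      rw [diagonal_pow, trace_diagonal] at this
      simp only [one_mul, Pi.pow_apply] at this ⊢
      exact_mod_cast this.symm) (f := Real.negMulLog) (by simp)
  simpa [vonNeumann] using this

end Diagonal

/-! ### Supports and isometries. -/

section Compression

variable {n m : Type*} [Fintype n] [Fintype m]

open scoped MatrixOrder in
-- With `A = Sᴴ S` the trace is the squared Hilbert-Schmidt norm of `Q Sᴴ`.
lemma mul_eq_zero_of_trace_conj_eq_zero {A : Matrix n n ℂ} (hA : A.PosSemidef) {Q : Matrix m n ℂ}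
    (h : (Q * A * Qᴴ).trace = 0) : Q * A = 0 := by
  classical
  obtain ⟨S, rfl⟩ := CStarAlgebra.nonneg_iff_eq_star_mul_self.mp hA.nonneg
  rw [star_eq_conjTranspose] at h ⊢
  have h1 : ((Q * Sᴴ) * (Q * Sᴴ)ᴴ).trace = 0 := by
    rw [← h]
    simp only [conjTranspose_mul, conjTranspose_conjTranspose, Matrix.mul_assoc]
  have h2 : Q * Sᴴ = 0 := trace_mul_conjTranspose_self_eq_zero_iff.1 h1
  rw [← Matrix.mul_assoc, h2, Matrix.zero_mul]

lemma trace_isometry_pow [DecidableEq n] [DecidableEq m] {V : Matrix n m ℂ} (hV : Vᴴ * V = 1)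
    (T : Matrix m m ℂ) (k : ℕ) : ((V * T * Vᴴ) ^ (k + 1)).trace = (T ^ (k + 1)).trace := by
  have h : (V * T * Vᴴ) ^ (k + 1) = V * T ^ (k + 1) * Vᴴ := by
    induction k with
    | zero => simp
    | succ k ih =>
      rw [pow_succ, ih, pow_succ T (k + 1)]
      have : V * T ^ (k + 1) * Vᴴ * (V * T * Vᴴ) = V * T ^ (k + 1) * (Vᴴ * V) * T * Vᴴ := by
        simp only [Matrix.mul_assoc]
      rw [this, hV, Matrix.mul_one, Matrix.mul_assoc V]
  rw [h, Matrix.mul_assoc, trace_mul_comm, Matrix.mul_assoc, hV, Matrix.mul_one]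

end Compression

end QuantumEntropy

/-! ### Nonnegativity of conditional mutual information and squashed entanglement. -/

namespace DensityMatrix

open QuantumEntropy

lemma entropy_eq_vonNeumann {n : Type*} [Fintype n] [DecidableEq n] (ρ : DensityMatrix n) :
    ρ.entropy = vonNeumann ρ.posSemidef.isHermitian / Real.log 2 :=
  rfl

lemma nonempty {n : Type*} [Fintype n] (ρ : DensityMatrix n) : Nonempty n := by
  by_contra h
  rw [not_nonempty_iff] at h
  have := ρ.trace_eq_one
  simp [Matrix.trace] at this

variable {A B E : Type*} [Fintype A] [Fintype B] [Fintype E]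

lemma margAE_apply (σ : DensityMatrix ((A × B) × E)) (p q : A × E) :
    σ.margAE.toMatrix p q = ∑ k, σ.toMatrix ((p.1, k), p.2) ((q.1, k), q.2) := by
  simp only [margAE, traceLeft, reindex, Matrix.sum_apply]
  rfl

lemma margBE_apply (σ : DensityMatrix ((A × B) × E)) (p q : B × E) :
    σ.margBE.toMatrix p q = ∑ k, σ.toMatrix ((k, p.1), p.2) ((k, q.1), q.2) := by
  simp only [margBE, traceLeft, reindex, Matrix.sum_apply]
  rfl

lemma traceLeft_apply (σ : DensityMatrix (A × E)) (p q : E) :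
    σ.traceLeft.toMatrix p q = ∑ k, σ.toMatrix (k, p) (k, q) := by
  simp [traceLeft, Matrix.sum_apply]

lemma traceRight_apply (σ : DensityMatrix (A × E)) (p q : A) :
    σ.traceRight.toMatrix p q = ∑ k, σ.toMatrix (p, k) (q, k) := by
  simp [traceRight, Matrix.sum_apply]

variable [DecidableEq A] [DecidableEq B] [DecidableEq E]

lemma condMutualInfo_nonneg (σ : DensityMatrix ((A × B) × E)) : 0 ≤ σ.condMutualInfo := by
  have hA : Nonempty A := ⟨σ.nonempty.some.1.1⟩
  -- Strong subadditivity traces out the two outer factors, so `E` has to stand in the middle.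
  set e : (B × E) × A ≃ (A × B) × E :=
    (Equiv.prodComm (B × E) A).trans (Equiv.prodAssoc A B E).symm with he
  have hT : (σ.toMatrix.submatrix e e).PosSemidef := σ.posSemidef.submatrix e
  have h := strong_subadditivity hT
  have h1 : vonNeumann hT.isHermitian = vonNeumann σ.posSemidef.isHermitian :=
    vonNeumann_submatrix _ _ _
  have h2 : vonNeumann (posSemidef_sum_blockDiag hT).isHermitian =
      vonNeumann σ.margBE.posSemidef.isHermitian := by
    refine vonNeumann_congr _ _ ?_
    ext p q
    rw [margBE_apply, Matrix.sum_apply]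
    rfl
  have h3 : vonNeumann σ.margAE.posSemidef.isHermitian =
      vonNeumann (posSemidef_traceFst hT).isHermitian := by
    have hs : σ.margAE.toMatrix = (traceFst (σ.toMatrix.submatrix e e)).submatrix
        (Equiv.prodComm A E) (Equiv.prodComm A E) := by
      ext p q
      rw [margAE_apply, traceFst_eq_sum, submatrix_apply, Matrix.sum_apply]
      rfl
    rw [← vonNeumann_submatrix (posSemidef_traceFst hT).isHermitian (Equiv.prodComm A E)
      ((posSemidef_traceFst hT).submatrix _).isHermitian]
    exact vonNeumann_congr _ _ hs
  have h4 : vonNeumann (posSemidef_sum_blockDiag (posSemidef_traceFst hT)).isHermitian =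
      vonNeumann σ.traceLeft.posSemidef.isHermitian := by
    refine vonNeumann_congr _ _ ?_
    ext p q
    rw [traceLeft_apply, Matrix.sum_apply, Fintype.sum_prod_type]
    refine sum_congr rfl fun a _ => ?_
    rw [traceFst_eq_sum, blockDiag_apply, Matrix.sum_apply]
    rfl
  rw [h1, h2, ← h3, h4] at h
  simp only [condMutualInfo, entropy_eq_vonNeumann, ← add_div, ← sub_div]
  exact div_nonneg (by linarith) (Real.log_nonneg (by norm_num))

lemma squashedEntanglement_nonneg (ρ : DensityMatrix (A × B)) : 0 ≤ ρ.squashedEntanglement := by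
  refine le_iInf fun n => le_iInf fun σ => le_iInf fun _ => ?_
  exact_mod_cast div_nonneg σ.condMutualInfo_nonneg zero_le_two

lemma entropy_eq_of_diagonal {n : Type*} [Fintype n] [DecidableEq n] (ρ : DensityMatrix n)
    (w : n → ℝ) (h : ρ.toMatrix = diagonal fun i => (w i : ℂ)) :
    ρ.entropy = (∑ i, Real.negMulLog (w i)) / Real.log 2 := by
  have h' : (diagonal fun i => (w i : ℂ)).IsHermitian := h ▸ ρ.posSemidef.isHermitian
  rw [entropy_eq_vonNeumann, vonNeumann_congr _ h' h, vonNeumann_diagonal]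

end DensityMatrix

/-! ### Extensions of a state supported on the range of an isometry. -/

namespace QuantumEntropy

open DensityMatrix

section Ampliation

variable {P C E : Type*} [Fintype E] [DecidableEq E]

/-- The matrix `N` tensored with the identity of the system `E`. -/
noncomputable def ampliation (E : Type*) [DecidableEq E] (N : Matrix P C ℂ) :
    Matrix (P × E) (E × C) ℂ :=
  of fun p q => if p.2 = q.1 then N p.1 q.2 else 0

lemma ampliation_conj_apply [Fintype C] (N : Matrix P C ℂ) (T : Matrix (E × C) (E × C) ℂ) (p q : P)
    (e e' : E) :
    (ampliation E N * T * (ampliation E N)ᴴ) (p, e) (q, e') =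
      ∑ c, ∑ c', N p c * T (e, c) (e', c') * star (N q c') := by
  simp only [ampliation, mul_apply, conjTranspose_apply, of_apply, Fintype.sum_prod_type, ite_mul,
    zero_mul, apply_ite star, star_zero, mul_ite, mul_zero]
  rw [sum_comm (t := univ (α := C))]
  simp only [sum_ite_irrel, sum_const_zero, sum_ite_eq, mem_univ, if_true, sum_mul]
  rw [sum_comm]

lemma ampliation_conjTranspose_mul [Fintype P] [DecidableEq C] {N : Matrix P C ℂ}
    (hN : Nᴴ * N = 1) :
    (ampliation E N)ᴴ * ampliation E N = 1 := by
  ext ⟨e, c⟩ ⟨e', c'⟩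
  have h := congrFun (congrFun hN c) c'
  rw [mul_apply] at h ⊢
  simp only [conjTranspose_apply, Complex.star_def] at h
  rw [Fintype.sum_prod_type_right]
  simp only [ampliation, conjTranspose_apply, of_apply, apply_ite star, star_zero, ite_mul,
    zero_mul, mul_ite, mul_zero, sum_ite_irrel, sum_const_zero, sum_ite_eq', mem_univ, if_true,
    Complex.star_def, h, one_apply, Prod.ext_iff, ite_and]
  simp only [eq_comm (a := e') (b := e)]

lemma ampliation_mul_conjTranspose_apply [Fintype C] (N : Matrix P C ℂ) (p q : P) (e e' : E) :
    (ampliation E N * (ampliation E N)ᴴ) (p, e) (q, e') = if e = e' then (N * Nᴴ) p q else 0 := by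
  simp only [ampliation, mul_apply, conjTranspose_apply, of_apply, apply_ite star, star_zero,
    ite_mul, zero_mul, mul_ite, mul_zero, Fintype.sum_prod_type, sum_ite_irrel, sum_const_zero,
    sum_ite_eq, mem_univ, if_true]

/-- Every extension of a state supported on the range of an isometry is supported on the range of
the ampliation of the isometry. -/
lemma extension_eq_conj [Fintype P] [Fintype C] [DecidableEq P] [DecidableEq C]
    {N : Matrix P C ℂ} (hN : Nᴴ * N = 1)
    (σ : DensityMatrix (P × E)) (hσ : N * Nᴴ * σ.traceRight.toMatrix = σ.traceRight.toMatrix) :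
    σ.toMatrix = ampliation E N *
      ((ampliation E N)ᴴ * σ.toMatrix * ampliation E N) * (ampliation E N)ᴴ := by
  set V := ampliation E N with hV
  have hVV : Vᴴ * V = 1 := ampliation_conjTranspose_mul hN
  -- `V * Vᴴ` is `N * Nᴴ` tensored with the identity, so this trace sees only the marginal, which `N
  -- * Nᴴ` fixes. The complementary projection therefore has weight zero in `σ`.
  have htr : (V * Vᴴ * σ.toMatrix).trace = 1 := by
    rw [← σ.traceRight.trace_eq_one, ← hσ]
    simp only [trace, Matrix.diag]
    rw [Fintype.sum_prod_type]
    refine sum_congr rfl fun p _ => ?_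
    have hp : ∀ e, (V * Vᴴ * σ.toMatrix) (p, e) (p, e) =
        ∑ q, (N * Nᴴ) p q * σ.toMatrix (q, e) (p, e) := fun e => by
      rw [mul_apply, Fintype.sum_prod_type]
      simp only [hV, ampliation_mul_conjTranspose_apply, ite_mul, zero_mul, sum_ite_eq, mem_univ,
        if_true]
    simp only [hp]
    rw [sum_comm, mul_apply]
    refine sum_congr rfl fun q _ => ?_
    rw [← mul_sum, traceRight_apply]
  have hQ : (1 - V * Vᴴ)ᴴ = 1 - V * Vᴴ := by simp
  have hQQ : (1 - V * Vᴴ) * (1 - V * Vᴴ) = 1 - V * Vᴴ := by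
    have : V * Vᴴ * (V * Vᴴ) = V * Vᴴ := by
      rw [Matrix.mul_assoc, ← Matrix.mul_assoc Vᴴ, hVV, Matrix.one_mul]
    rw [mul_sub, mul_one, sub_mul, one_mul, this, sub_self, sub_zero]
  have h0 : (1 - V * Vᴴ) * σ.toMatrix = 0 := by
    refine mul_eq_zero_of_trace_conj_eq_zero σ.posSemidef ?_
    rw [hQ, trace_mul_comm, ← mul_assoc, hQQ, sub_mul, one_mul, trace_sub, htr, σ.trace_eq_one,
      sub_self]
  have h1 : V * Vᴴ * σ.toMatrix = σ.toMatrix := by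
    rw [sub_mul, one_mul, sub_eq_zero] at h0
    exact h0.symm
  have h2 : σ.toMatrix * (V * Vᴴ) = σ.toMatrix := by
    have := congrArg conjTranspose h1
    simpa only [conjTranspose_mul, conjTranspose_conjTranspose,
      σ.posSemidef.isHermitian.eq] using this
  conv_lhs => rw [← h2, ← h1]
  simp only [Matrix.mul_assoc]

end Ampliation

end QuantumEntropy

/-! ### The Fourier transform and the support of the flower state. -/

namespace Flower

open QuantumEntropy DensityMatrix

variable {G : Type*} [AddCommGroup G] [Fintype G] [DecidableEq G] (φ : G ≃+ AddChar G ℂ)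

section Unitary

lemma inv_sqrt_mul_self {x : ℝ} (hx : 0 ≤ x) :
    ((1 / √x : ℝ) : ℂ) * ((1 / √x : ℝ) : ℂ) = ((x⁻¹ : ℝ) : ℂ) := by
  rw [← Complex.ofReal_mul, div_mul_div_comm, Real.mul_self_sqrt hx, one_mul, one_div]

lemma fourierMatrix_mul_conjTranspose : fourierMatrix φ * (fourierMatrix φ)ᴴ = 1 := by
  rw [mul_eq_one_comm]
  have hd : (Fintype.card G : ℂ) ≠ 0 := by exact_mod_cast Fintype.card_ne_zero
  have hs := inv_sqrt_mul_self (Nat.cast_nonneg (α := ℝ) (Fintype.card G))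
  rw [Complex.ofReal_inv, Complex.ofReal_natCast] at hs
  ext i j
  have h1 : ∀ k, (fourierMatrix φ)ᴴ i k * fourierMatrix φ k j =
      (Fintype.card G : ℂ)⁻¹ * φ (j - i) k := fun k => by
    rw [← hs, conjTranspose_apply, fourierMatrix, of_apply, of_apply, star_mul', Complex.star_def,
      Complex.conj_ofReal, ← AddChar.map_neg_eq_conj, map_sub, AddChar.sub_apply]
    ring
  rw [mul_apply]
  simp only [h1]
  rw [← mul_sum, AddChar.sum_eq_ite, one_apply]
  by_cases h : i = j
  · simp [h, hd]
  · simp [h, sub_eq_zero, Ne.symm h]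

lemma flowerUnitary_mul_conjTranspose (j : Fin 2) :
    flowerUnitary φ j * (flowerUnitary φ j)ᴴ = 1 := by
  unfold flowerUnitary
  split_ifs
  · simp
  · exact fourierMatrix_mul_conjTranspose φ

lemma flowerUnitary_conjTranspose_mul (j : Fin 2) :
    (flowerUnitary φ j)ᴴ * flowerUnitary φ j = 1 :=
  mul_eq_one_comm.1 (flowerUnitary_mul_conjTranspose φ j)

omit [DecidableEq G] in
lemma norm_sq_fourierMatrix (c i : G) :
    ‖fourierMatrix φ c i‖ ^ 2 = (Fintype.card G : ℝ)⁻¹ := by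
  simp [fourierMatrix, AddChar.norm_apply]

end Unitary

section Isometry

/-- The isometry from `C` onto the support of the flower state. -/
noncomputable def flowerIsometry : Matrix ((G × Fin 2) × (G × Fin 2)) G ℂ :=
  of fun p c => if p.1 = p.2 then ((1 / √2 : ℝ) : ℂ) * flowerUnitary φ p.1.2 c p.1.1 else 0

lemma inv_sqrt_two_mul_self : ((1 / √2 : ℝ) : ℂ) * ((1 / √2 : ℝ) : ℂ) = (1 / 2 : ℂ) := by
  simpa using inv_sqrt_mul_self zero_le_two

/-- Each unitary `U_j` contributes half of the identity through the orthonormality of its rows. -/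
lemma flowerIsometry_conjTranspose_mul : (flowerIsometry φ)ᴴ * flowerIsometry φ = 1 := by
  ext c c'
  have h1 : ∀ j, ∑ i, star (flowerUnitary φ j c i) * flowerUnitary φ j c' i =
      (1 : Matrix G G ℂ) c' c := fun j => by
    rw [← flowerUnitary_mul_conjTranspose φ j, mul_apply]
    exact sum_congr rfl fun i _ => by rw [conjTranspose_apply, mul_comm]
  have h2 : ∀ x : G × Fin 2, ∑ y, (flowerIsometry φ)ᴴ c (x, y) * flowerIsometry φ (x, y) c' =
      (1 / 2 : ℂ) * (star (flowerUnitary φ x.2 c x.1) * flowerUnitary φ x.2 c' x.1) := fun x => by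
    rw [sum_eq_single x]
    · rw [conjTranspose_apply, flowerIsometry, of_apply, of_apply, if_pos rfl, if_pos rfl,
        star_mul', Complex.star_def, Complex.conj_ofReal, ← inv_sqrt_two_mul_self]
      ring
    · intro y _ hy
      simp [flowerIsometry, Ne.symm hy]
    · simp
  rw [mul_apply, Fintype.sum_prod_type]
  simp only [h2]
  rw [Fintype.sum_prod_type_right]
  simp only [← mul_sum, h1, one_apply, eq_comm (a := c) (b := c')]
  simp

lemma flowerState_toMatrix : (flowerState φ).toMatrix =
    ((Fintype.card G : ℂ)⁻¹) • (flowerIsometry φ * (flowerIsometry φ)ᴴ) := by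
  have h1 : ∀ p c, flowerVector φ (p, c) =
      ((1 / √(Fintype.card G : ℝ) : ℝ) : ℂ) * flowerIsometry φ p c := by
    rintro ⟨⟨a, a'⟩, ⟨b, b'⟩⟩ c
    rw [flowerVector_apply, flowerIsometry, of_apply]
    simp only [Prod.mk.injEq]
    split_ifs
    · rw [← mul_assoc, ← Complex.ofReal_mul, div_mul_div_comm, mul_one,
        mul_comm (√_), Real.sqrt_mul zero_le_two]
    · simp
  have hs := inv_sqrt_mul_self (Nat.cast_nonneg (α := ℝ) (Fintype.card G))
  rw [Complex.ofReal_inv, Complex.ofReal_natCast] at hs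
  ext p q
  rw [flowerState, traceRight_apply, Matrix.smul_apply, mul_apply, smul_eq_mul, mul_sum]
  refine sum_congr rfl fun c _ => ?_
  change flowerVector φ (p, c) * star (flowerVector φ (q, c)) = _
  rw [h1, h1, ← hs, star_mul', Complex.star_def, Complex.conj_ofReal, conjTranspose_apply,
    Complex.star_def]
  ring

end Isometry

/-! ### The lower bound for arbitrary extensions. -/

section Extension

variable {E : Type*} [Fintype E] [DecidableEq E]

lemma flowerIsometry_projection_mul :
    flowerIsometry φ * (flowerIsometry φ)ᴴ * (flowerState φ).toMatrix =
      (flowerState φ).toMatrix := by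
  rw [flowerState_toMatrix, Matrix.mul_smul, Matrix.mul_assoc,
    ← Matrix.mul_assoc (flowerIsometry φ)ᴴ, flowerIsometry_conjTranspose_mul, Matrix.one_mul]

/-- The unnormalized state of `E` for a given measurement outcome on `AA'`. -/
noncomputable def outcomeBlock (T : Matrix (E × G) (E × G) ℂ) (x : G × Fin 2) : Matrix E E ℂ :=
  conditionalBlock (fun c => flowerUnitary φ x.2 c x.1) T

lemma posSemidef_outcomeBlock {T : Matrix (E × G) (E × G) ℂ} (hT : T.PosSemidef)
    (x : G × Fin 2) : (outcomeBlock φ T x).PosSemidef :=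
  posSemidef_conditionalBlock _ hT

lemma ampliation_flowerIsometry_conj_apply (T : Matrix (E × G) (E × G) ℂ)
    (x y x' y' : G × Fin 2) (e e' : E) (h : ¬ (x = y ∧ x' = y')) :
    (ampliation E (flowerIsometry φ) * T * (ampliation E (flowerIsometry φ))ᴴ)
      ((x, y), e) ((x', y'), e') = 0 := by
  rw [ampliation_conj_apply]
  refine sum_eq_zero fun c _ => sum_eq_zero fun c' _ => ?_
  rcases not_and_or.1 h with h | h <;> simp [flowerIsometry, h]

lemma ampliation_flowerIsometry_conj_apply_self (T : Matrix (E × G) (E × G) ℂ)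
    (x : G × Fin 2) (e e' : E) :
    (ampliation E (flowerIsometry φ) * T * (ampliation E (flowerIsometry φ))ᴴ)
      ((x, x), e) ((x, x), e') = (1 / 2 : ℂ) * outcomeBlock φ T x e e' := by
  rw [ampliation_conj_apply, outcomeBlock, conditionalBlock_apply, mul_sum]
  refine sum_congr rfl fun c _ => ?_
  rw [mul_sum]
  refine sum_congr rfl fun c' _ => ?_
  rw [flowerIsometry, of_apply, of_apply, if_pos rfl, if_pos rfl, star_mul', Complex.star_def,
    Complex.conj_ofReal, ← inv_sqrt_two_mul_self]
  ring

lemma sum_outcomeBlock (T : Matrix (E × G) (E × G) ℂ) (j : Fin 2) :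
    ∑ i, outcomeBlock φ T (i, j) = ∑ i, T.blockDiag i :=
  sum_conditionalBlock (flowerUnitary_mul_conjTranspose φ j) T

lemma sum_half_outcomeBlock (T : Matrix (E × G) (E × G) ℂ) :
    ∑ x, (1 / 2 : ℂ) • outcomeBlock φ T x = ∑ i, T.blockDiag i := by
  rw [← smul_sum, Fintype.sum_prod_type_right]
  simp only [sum_outcomeBlock, sum_const, card_univ, Fintype.card_fin]
  rw [two_smul, smul_add, ← add_smul]
  norm_num

/-- The reductions to `AA'E` and to `BB'E` both have this form. The block weight `1/2` halves the
entropies and adds `log 2` times the total trace. -/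
lemma vonNeumann_half_outcomeBlock {T : Matrix (E × G) (E × G) ℂ} (hT : T.PosSemidef)
    {A : Matrix ((G × Fin 2) × E) ((G × Fin 2) × E) ℂ} (hA : A.IsHermitian)
    (h : A = (blockDiagonal fun x => (1 / 2 : ℂ) • outcomeBlock φ T x).submatrix
      (Equiv.prodComm _ _) (Equiv.prodComm _ _)) :
    vonNeumann hA = (∑ x, vonNeumann (posSemidef_outcomeBlock φ hT x).isHermitian) / 2 +
      Real.log 2 * T.trace.re := by
  have := vonNeumann_eq_sum hA (fun x => (posSemidef_outcomeBlock φ hT x).isHermitian)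
    (fun _ => 1) (fun _ => 1 / 2) fun k => by
      rw [h, trace_submatrix_pow, ← blockDiagonal_pow, trace_blockDiagonal]
      simp [smul_pow]
  rw [this]
  have htr : ∑ x, (1 / 2 : ℝ) * (outcomeBlock φ T x).trace.re = T.trace.re := by
    rw [← trace_sum_blockDiag T, ← sum_half_outcomeBlock φ T, trace_sum, Complex.re_sum]
    refine sum_congr rfl fun x _ => ?_
    rw [trace_smul, smul_eq_mul, ← Complex.re_ofReal_mul]
    norm_num
  have hl : Real.negMulLog (1 / 2) = 1 / 2 * Real.log 2 := by
    rw [Real.negMulLog, one_div, Real.log_inv]; ring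
  simp only [one_mul, sum_add_distrib, hl, ← mul_sum, ← htr]
  ring

/-- The conditional mutual information of an extension of the flower state, in terms of the state
`T` of `E` and the purifying system. -/
lemma condMutualInfo_eq (σ : DensityMatrix (((G × Fin 2) × (G × Fin 2)) × E))
    {T : Matrix (E × G) (E × G) ℂ} (hT : T.PosSemidef)
    (h : σ.toMatrix =
      ampliation E (flowerIsometry φ) * T * (ampliation E (flowerIsometry φ))ᴴ) :
    T.trace = 1 ∧ σ.condMutualInfo =
      (∑ x, vonNeumann (posSemidef_outcomeBlock φ hT x).isHermitian + 2 * Real.log 2 -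
        vonNeumann (posSemidef_sum_blockDiag hT).isHermitian - vonNeumann hT.isHermitian) /
          Real.log 2 := by
  have hV : (ampliation E (flowerIsometry φ))ᴴ * ampliation E (flowerIsometry φ) = 1 :=
    ampliation_conjTranspose_mul (flowerIsometry_conjTranspose_mul φ)
  have hpow : ∀ k, (σ.toMatrix ^ (k + 1)).trace = (T ^ (k + 1)).trace := fun k => by
    rw [h, trace_isometry_pow hV]
  have htr : T.trace = 1 := by
    have := hpow 0
    rw [zero_add, pow_one, pow_one, σ.trace_eq_one] at this
    exact this.symm
  have h1 : vonNeumann σ.posSemidef.isHermitian = vonNeumann hT.isHermitian :=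
    vonNeumann_eq_of_trace_pow _ _ hpow
  have h2 : vonNeumann σ.traceLeft.posSemidef.isHermitian =
      vonNeumann (posSemidef_sum_blockDiag hT).isHermitian := by
    refine vonNeumann_congr _ _ ?_
    ext e e'
    rw [traceLeft_apply, ← sum_half_outcomeBlock φ T, Matrix.sum_apply, Fintype.sum_prod_type, h]
    refine sum_congr rfl fun x _ => ?_
    rw [sum_eq_single x, ampliation_flowerIsometry_conj_apply_self, Matrix.smul_apply, smul_eq_mul]
    · intro y _ hy
      exact ampliation_flowerIsometry_conj_apply φ T _ _ _ _ _ _ fun h => hy h.1.symm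
    · simp
  -- Tracing out `BB'`, which carries a copy of the label `x`, removes the coherences between
  -- different labels.
  have h3 := vonNeumann_half_outcomeBlock φ hT σ.margAE.posSemidef.isHermitian (by
    ext ⟨x, e⟩ ⟨x', e'⟩
    rw [margAE_apply, h]
    simp only [submatrix_apply, Equiv.prodComm_apply, Prod.swap_prod_mk, blockDiagonal_apply]
    split_ifs with hx
    · subst hx
      rw [sum_eq_single x, ampliation_flowerIsometry_conj_apply_self, Matrix.smul_apply,
        smul_eq_mul]
      · intro y _ hy
        exact ampliation_flowerIsometry_conj_apply φ T _ _ _ _ _ _ fun h => hy h.1.symm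
      · simp
    · exact sum_eq_zero fun y _ => ampliation_flowerIsometry_conj_apply φ T _ _ _ _ _ _
        fun h => hx (h.1.trans h.2.symm))
  have h4 := vonNeumann_half_outcomeBlock φ hT σ.margBE.posSemidef.isHermitian (by
    ext ⟨x, e⟩ ⟨x', e'⟩
    rw [margBE_apply, h]
    simp only [submatrix_apply, Equiv.prodComm_apply, Prod.swap_prod_mk, blockDiagonal_apply]
    split_ifs with hx
    · subst hx
      rw [sum_eq_single x, ampliation_flowerIsometry_conj_apply_self, Matrix.smul_apply,
        smul_eq_mul]
      · intro y _ hy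
        exact ampliation_flowerIsometry_conj_apply φ T _ _ _ _ _ _ fun h => hy h.1
      · simp
    · exact sum_eq_zero fun y _ => ampliation_flowerIsometry_conj_apply φ T _ _ _ _ _ _
        fun h => hx (h.1.symm.trans h.2))
  refine ⟨htr, ?_⟩
  rw [htr, Complex.one_re, mul_one] at h3 h4
  simp only [condMutualInfo, entropy_eq_vonNeumann, h1, h2, h3, h4]
  ring

lemma le_condMutualInfo (σ : DensityMatrix (((G × Fin 2) × (G × Fin 2)) × E))
    (hσ : σ.traceRight = flowerState φ) :
    2 + Real.logb 2 (Fintype.card G) ≤ σ.condMutualInfo := by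
  have hT := σ.posSemidef.conjTranspose_mul_mul_same (ampliation E (flowerIsometry φ))
  have hN := flowerIsometry_conjTranspose_mul φ
  obtain ⟨htr, hI⟩ := condMutualInfo_eq φ σ hT
    (extension_eq_conj hN σ (by rw [hσ, flowerIsometry_projection_mul]))
  set T := (ampliation E (flowerIsometry φ))ᴴ * σ.toMatrix * ampliation E (flowerIsometry φ)
  -- The outcome blocks with `j = 0` are the diagonal blocks of `T`, and those with `j = 1` the
  -- blocks conditional on a Fourier measurement: the two sums on the right of the relation.
  have hu := uncertainty_relation (fourierMatrix_mul_conjTranspose φ) (norm_sq_fourierMatrix φ) hT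
  have h0 : ∀ i, vonNeumann (posSemidef_outcomeBlock φ hT (i, 0)).isHermitian =
      vonNeumann (posSemidef_blockDiag hT i).isHermitian := fun i => by
    refine vonNeumann_congr _ _ ?_
    ext e e'
    rw [outcomeBlock, conditionalBlock_apply]
    simp [flowerUnitary, one_apply, blockDiag_apply, apply_ite (starRingEnd ℂ)]
  have h1 : ∀ i, vonNeumann (posSemidef_outcomeBlock φ hT (i, 1)).isHermitian =
      vonNeumann (posSemidef_conditionalBlock (fun c => fourierMatrix φ c i) hT).isHermitian :=
    fun i => vonNeumann_congr _ _ (by simp [outcomeBlock, flowerUnitary])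
  rw [hI, Fintype.sum_prod_type_right, Fin.sum_univ_two]
  simp only [h0, h1]
  rw [htr, Complex.one_re, mul_one] at hu
  have hl : 0 < Real.log 2 := Real.log_pos (by norm_num)
  rw [le_div_iff₀ hl, Real.logb, add_mul, div_mul_cancel₀ _ hl.ne']
  linarith

end Extension

/-! ### The trivial extension attains the bound. -/

section TrivialExtension

/-- The flower state with a trivial extending system. -/
noncomputable def trivialExtension :
    DensityMatrix (((G × Fin 2) × (G × Fin 2)) × Fin 1) :=
  (flowerState φ).reindex (Equiv.prodUnique _ _).symm

lemma traceRight_trivialExtension : (trivialExtension φ).traceRight = flowerState φ := by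
  ext p q
  rw [traceRight_apply]
  simp [trivialExtension, DensityMatrix.reindex]

lemma condMutualInfo_trivialExtension :
    (trivialExtension φ).condMutualInfo = 2 + Real.logb 2 (Fintype.card G) := by
  have hd : (Fintype.card G : ℝ) ≠ 0 := by exact_mod_cast Fintype.card_ne_zero
  have hdc : (Fintype.card G : ℂ) ≠ 0 := by exact_mod_cast Fintype.card_ne_zero
  -- With `E` trivial, `T` is maximally mixed on `C`: `S(EC) = log d`, `S(E) = 0`, and the `2d`
  -- outcome blocks, each the scalar `1/d`, have total entropy `2 log d`.
  set T : Matrix (Fin 1 × G) (Fin 1 × G) ℂ :=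
    diagonal fun _ => (((Fintype.card G : ℝ)⁻¹ : ℝ) : ℂ) with hTdef
  have hT : T.PosSemidef := by
    refine PosSemidef.diagonal fun _ => ?_
    rw [Pi.zero_apply, Complex.zero_le_real]
    positivity
  have h : (trivialExtension φ).toMatrix = ampliation (Fin 1) (flowerIsometry φ) * T *
      (ampliation (Fin 1) (flowerIsometry φ))ᴴ := by
    ext ⟨p, e⟩ ⟨q, e'⟩
    rw [ampliation_conj_apply]
    have h1 : (trivialExtension φ).toMatrix (p, e) (q, e') = (flowerState φ).toMatrix p q := rfl
    rw [h1, flowerState_toMatrix, Matrix.smul_apply, mul_apply, smul_eq_mul, mul_sum]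
    refine sum_congr rfl fun c _ => ?_
    rw [sum_eq_single c]
    · rw [hTdef, Subsingleton.elim e' e, diagonal_apply_eq, conjTranspose_apply]
      push_cast
      ring
    · intro c' _ hc
      rw [hTdef, diagonal_apply_ne _ (by simp [Ne.symm hc])]
      simp
    · simp
  obtain ⟨htr, hI⟩ := condMutualInfo_eq φ _ hT h
  have hneg : Real.negMulLog (Fintype.card G : ℝ)⁻¹ =
      (Fintype.card G : ℝ)⁻¹ * Real.log (Fintype.card G) := by
    rw [Real.negMulLog, Real.log_inv]; ring
  have e1 : vonNeumann hT.isHermitian = Real.log (Fintype.card G) := by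
    rw [vonNeumann_diagonal]
    simp [hneg, hd]
  have e2 : vonNeumann (posSemidef_sum_blockDiag hT).isHermitian = 0 := by
    have : ∑ i, T.blockDiag i = diagonal fun _ => ((1 : ℝ) : ℂ) := by
      ext e e'
      rw [Subsingleton.elim e' e, Matrix.sum_apply]
      simp [hTdef, blockDiag_apply, hdc]
    rw [vonNeumann_congr _ (this ▸ (posSemidef_sum_blockDiag hT).isHermitian) this,
      vonNeumann_diagonal]
    simp
  have e3 : ∀ x, vonNeumann (posSemidef_outcomeBlock φ hT x).isHermitian =
      (Fintype.card G : ℝ)⁻¹ * Real.log (Fintype.card G) := fun x => by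
    have : outcomeBlock φ T x = diagonal fun _ => (((Fintype.card G : ℝ)⁻¹ : ℝ) : ℂ) := by
      ext e e'
      have hu := congrFun (congrFun (flowerUnitary_conjTranspose_mul φ x.2) x.1) x.1
      rw [mul_apply, one_apply_eq] at hu
      rw [Subsingleton.elim e' e, outcomeBlock, conditionalBlock_apply, diagonal_apply_eq,
        ← mul_one (((Fintype.card G : ℝ)⁻¹ : ℝ) : ℂ), ← hu, mul_sum]
      refine sum_congr rfl fun c _ => ?_
      rw [sum_eq_single c]
      · rw [hTdef, diagonal_apply_eq, conjTranspose_apply]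
        ring
      · intro c' _ hc
        rw [hTdef, diagonal_apply_ne _ (by simp [Ne.symm hc])]
        simp
      · simp
    rw [vonNeumann_congr _ (this ▸ (posSemidef_outcomeBlock φ hT x).isHermitian) this,
      vonNeumann_diagonal]
    simp [hneg]
  have hl : Real.log 2 ≠ 0 := (Real.log_pos (by norm_num)).ne'
  rw [hI, e1, e2]
  simp only [e3, sum_const, card_univ, Fintype.card_prod, Fintype.card_fin, nsmul_eq_mul,
    Real.logb]
  push_cast
  field_simp
  ring

end TrivialExtension

theorem squashedEntanglement_flowerState :
    (flowerState φ).squashedEntanglement =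
      ((1 + Real.logb 2 (Fintype.card G) / 2 : ℝ) : EReal) := by
  apply le_antisymm
  · refine (iInf_le _ 1).trans <| (iInf_le _ (trivialExtension φ)).trans <|
      (iInf_le _ (traceRight_trivialExtension φ)).trans ?_
    rw [condMutualInfo_trivialExtension, EReal.coe_le_coe_iff]
    linarith
  · refine le_iInf fun n => le_iInf fun σ => le_iInf fun hσ => ?_
    rw [EReal.coe_le_coe_iff]
    linarith [le_condMutualInfo φ σ hσ]

/-! ### Discarding `A'`. -/

section Discarded

/-- Tracing out `A'` dephases `j`, its copy in `B'`; for fixed `j` the unitarity of `U_j` removes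
the coherences between different `i`. What remains is classical. -/
lemma discardA'_flowerState_toMatrix : (flowerState φ).discardA'.toMatrix =
    diagonal fun p => ((if p.1 = p.2.1 then (2 * Fintype.card G : ℝ)⁻¹ else 0 : ℝ) : ℂ) := by
  have hd : (Fintype.card G : ℂ) ≠ 0 := by exact_mod_cast Fintype.card_ne_zero
  ext ⟨a, b, b'⟩ ⟨c, e, e'⟩
  have h1 : (flowerState φ).discardA'.toMatrix (a, b, b') (c, e, e') =
      ∑ k, (flowerState φ).toMatrix ((a, k), (b, b')) ((c, k), (e, e')) := by
    simp only [discardA', traceLeft, DensityMatrix.reindex, Matrix.sum_apply]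
    rfl
  have h2 : ∀ k, (flowerState φ).toMatrix ((a, k), (b, b')) ((c, k), (e, e')) =
      if a = b ∧ k = b' ∧ c = e ∧ k = e' then
        (2 * Fintype.card G : ℂ)⁻¹ * (1 : Matrix G G ℂ) c a else 0 := fun k => by
    rw [flowerState_toMatrix, Matrix.smul_apply, mul_apply]
    simp only [flowerIsometry, conjTranspose_apply, of_apply, Prod.mk.injEq]
    by_cases hab : a = b ∧ k = b'
    · by_cases hce : c = e ∧ k = e'
      · rw [if_pos ⟨hab.1, hab.2, hce.1, hce.2⟩, ← flowerUnitary_conjTranspose_mul φ k, mul_apply,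
          smul_eq_mul, mul_sum, mul_sum]
        refine sum_congr rfl fun x _ => ?_
        rw [if_pos hab, if_pos hce, star_mul', Complex.star_def, Complex.conj_ofReal,
          conjTranspose_apply, mul_inv, ← one_div (2 : ℂ), ← inv_sqrt_two_mul_self,
          Complex.star_def]
        ring
      · rw [if_neg fun h => hce h.2.2]
        simp [hce]
    · rw [if_neg fun h => hab ⟨h.1, h.2.1⟩]
      simp [hab]
  rw [h1]
  simp only [h2, diagonal_apply, one_apply, Prod.mk.injEq]
  clear h1 h2
  by_cases hab : a = b
  · by_cases hce : c = e
    · by_cases hb : b' = e'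
      · by_cases hac : c = a <;> subst_vars <;> simp_all [eq_comm]
      · have : ∀ k, ¬ (k = b' ∧ k = e') := fun k h => hb (h.1.symm.trans h.2)
        simp [hab, hce, hb, this]
    · have : ¬ (a = c ∧ b = e ∧ b' = e') := fun h => hce (by rw [← h.1, hab, h.2.1])
      simp [hce, this]
  · simp [hab]

/-- The classical extension of the flower state without `A'` in which `E` is a copy of the label. -/
noncomputable def classicalExtension (G : Type*) [AddCommGroup G] [Fintype G] [DecidableEq G] :
    DensityMatrix ((G × (G × Fin 2)) × Fin (Fintype.card G)) where
  toMatrix := diagonal fun p => ((if p.1.1 = p.1.2.1 ∧ Fintype.equivFin G p.1.1 = p.2 then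
    (2 * Fintype.card G : ℝ)⁻¹ else 0 : ℝ) : ℂ)
  posSemidef := by
    refine PosSemidef.diagonal fun p => ?_
    rw [Pi.zero_apply, Complex.zero_le_real]
    positivity
  trace_eq_one := by
    have hd : (Fintype.card G : ℝ) ≠ 0 := by exact_mod_cast Fintype.card_ne_zero
    rw [trace_diagonal, ← Complex.ofReal_sum, ← Complex.ofReal_one]
    congr 1
    simp only [Fintype.sum_prod_type, ite_and, sum_ite_irrel, sum_const_zero, sum_ite_eq, mem_univ,
      if_true]
    simp
    field_simp

lemma traceRight_classicalExtension :
    (classicalExtension G).traceRight = (flowerState φ).discardA' := by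
  ext p q
  rw [discardA'_flowerState_toMatrix, traceRight_apply]
  simp only [classicalExtension, diagonal_apply, Prod.mk.injEq]
  by_cases h : p = q
  · subst h
    simp [apply_ite Complex.ofReal, ite_and]
  · simp [h]

/-- Given the label in `E`, the system `A` is deterministic. In entropies, `AE` and `E` have `log
d`, while `BB'E` and the whole have `log 2d`. -/
lemma condMutualInfo_classicalExtension : (classicalExtension G).condMutualInfo = 0 := by
  have hd : (Fintype.card G : ℝ) ≠ 0 := by exact_mod_cast Fintype.card_ne_zero
  have h1 := (classicalExtension G).entropy_eq_of_diagonal _ rfl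
  have h2 := (classicalExtension G).margAE.entropy_eq_of_diagonal
    (fun p => if Fintype.equivFin G p.1 = p.2 then (Fintype.card G : ℝ)⁻¹ else 0) (by
      ext p q
      rw [margAE_apply]
      simp only [classicalExtension, diagonal_apply, Prod.mk.injEq]
      by_cases h : p = q
      · subst h
        simp [apply_ite Complex.ofReal, Fintype.sum_prod_type, ite_and, sum_add_distrib,
          ← Equiv.eq_symm_apply]
        split_ifs <;> ring
      · have h' : ¬ (p.1 = q.1 ∧ p.2 = q.2) := fun h' => h (Prod.ext h'.1 h'.2)
        simp [h, h'])
  have h3 := (classicalExtension G).margBE.entropy_eq_of_diagonal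
    (fun p => if Fintype.equivFin G p.1.1 = p.2 then (2 * Fintype.card G : ℝ)⁻¹ else 0) (by
      ext p q
      rw [margBE_apply]
      simp only [classicalExtension, diagonal_apply, Prod.mk.injEq]
      by_cases h : p = q
      · subst h
        simp [apply_ite Complex.ofReal, ite_and, ← Equiv.eq_symm_apply]
      · have h' : ¬ (p.1 = q.1 ∧ p.2 = q.2) := fun h' => h (Prod.ext h'.1 h'.2)
        simp [h, h'])
  have h4 := (classicalExtension G).traceLeft.entropy_eq_of_diagonal
    (fun p => (Fintype.card G : ℝ)⁻¹) (by
      ext p q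
      rw [traceLeft_apply]
      simp only [classicalExtension, diagonal_apply, Prod.mk.injEq]
      by_cases h : p = q
      · subst h
        simp [apply_ite Complex.ofReal, Fintype.sum_prod_type, ite_and, sum_add_distrib,
          ← Equiv.eq_symm_apply]
        ring
      · simp [h])
  rw [condMutualInfo, h1, h2, h3, h4, ← add_div, ← sub_div, ← sub_div, div_eq_zero_iff]
  left
  simp only [apply_ite Real.negMulLog, Real.negMulLog_zero, Fintype.sum_prod_type, ite_and,
    sum_ite_irrel, sum_const_zero, sum_ite_eq, mem_univ,
      if_true, sum_const, card_univ, Fintype.card_fin, nsmul_eq_mul]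
  simp
  ring

end Discarded

theorem squashedEntanglement_discardA'_flowerState :
    (flowerState φ).discardA'.squashedEntanglement = 0 := by
  refine le_antisymm ?_ (squashedEntanglement_nonneg _)
  refine (iInf_le _ (Fintype.card G)).trans <| (iInf_le _ (classicalExtension G)).trans <|
    (iInf_le _ (traceRight_classicalExtension φ)).trans ?_
  simp [condMutualInfo_classicalExtension]

end Flower

theorem squashedEntanglementIsLockable : SquashedEntanglementIsLockable := by
  intro K
  obtain ⟨m, hm⟩ := exists_nat_ge K
  -- The order `d = 2 ^ (2 * m)` makes the gap `1 + (log d) / 2` equal to `1 + m`, which exceeds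
  -- `K`.
  have : NeZero (2 ^ (2 * m)) := ⟨by positivity⟩
  refine ⟨ZMod (2 ^ (2 * m)), ZMod (2 ^ (2 * m)) × Fin 2, inferInstance, inferInstance,
    inferInstance, inferInstance, flowerState AddChar.zmodAddEquiv, _, 0,
    Flower.squashedEntanglement_flowerState _,
    Flower.squashedEntanglement_discardA'_flowerState _, ?_⟩
  rw [ZMod.card, Nat.cast_pow, Nat.cast_ofNat, Real.logb_pow, Real.logb_self_eq_one one_lt_two]
  push_cast
  linarith

theorem proposition2 :
    (∀ (G : Type*) [AddCommGroup G] [Fintype G] [DecidableEq G] (φ : G ≃+ AddChar G ℂ),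
      (flowerState φ).squashedEntanglement =
          ((1 + Real.logb 2 (Fintype.card G) / 2 : ℝ) : EReal) ∧
        (flowerState φ).discardA'.squashedEntanglement = 0) ∧
      SquashedEntanglementIsLockable :=
  ⟨fun _ _ _ _ φ => ⟨Flower.squashedEntanglement_flowerState φ,
    Flower.squashedEntanglement_discardA'_flowerState φ⟩, squashedEntanglementIsLockable⟩
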